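/- Let $n\ge 1$ and let $0<x<y$ be coprime integers. The path multigraph $P^{x,y}_n$ has vertices $u_0,\dots,u_{n+1}$; for $1\le k\le n$ there are $x+y$ arcs $a^k_0,\dots,a^k_{x+y-1}$ going out of $u_k$, where $a^k_i$ goes to $u_{k+1}$ if $i<x$ and to $u_{k-1}$ if $i\ge x$; $u_0$ and $u_{n+1}$ are sinks (no outgoing arcs). The rotor order is $\theta(a^k_i)=a^k_{i+1 \bmod (x+y)}$. A rotor configuration $\rho$ chooses for each $k\in\{1,\dots,n\}$ an arc $\rho(u_k)$ going out of $u_k$; $\mathcal R$ is the set of rotor configurations. A particle configuration is a map $\sigma:\{u_0,\dots,u_{n+1}\}\to\mathbb Z$; $\Sigma$ is the group of these, and $\deg\sigma=\sum_u\sigma(u)$. For $1\le k\le n$, routing at $u_k$ is the bijection of $\mathcal R\times\Sigma$ that moves one particle from $u_k$ to the head of $\rho(u_k)$ and then replaces $\rho(u_k)$ by $\theta(\rho(u_k))$. These bijections commute; for $r\in\mathbb Z^{\{u_1,\dots,u_n\}}$ let $\mathrm{routing}^r$ be the composition of their $r(u_k)$-th powers (inverses for negative exponents). Write $(\rho,\sigma)\sim(\rho',\sigma')$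 if $\mathrm{routing}^r(\rho,\sigma)=(\rho',\sigma')$ for some $r$, and let $\mathrm{routing}^\infty(\rho,\sigma)$ be the set of all $(\rho',\sigma')\sim(\rho,\sigma)$ with $\sigma'(u_k)=0$ for $1\le k\le n$. Put $F=\sum_{i=0}^n x^{n-i}y^i$. Running times count elementary operations of a single program (one that works for all $n,x,y$ and all inputs) over integer registers and arrays, where memory access, comparison, addition, subtraction, multiplication and integer division with remainder cost one operation each. The inputs are $n,x,y$ together with, as the case may be, an integer, or the values of $\sigma$ and the indices $i$ with $\rho(u_k)=a^k_i$. The constants in $O(\cdot)$ are absolute. **Theorem.** For all such $n,x,y$ there are a linear function $h:\Sigma\to\mathbb Z$ and a function $g:\mathcal R\to\mathbb Z$ such that the following hold. (i) For all $(\rho,\sigma)\in\mathcal R\times\Sigma$, the set $\mathrm{routing}^\infty(\rho,\sigma)$ is nonempty, and for every $(\rho',\sigma')$ in it and every $m\in\mathbb Z$: $\sigma'(u_{n+1})=m$ if and only if $g(\rho)-h(\sigma)+mF\in g(\mathcal R)$. (ii) $g(\mathcal R)$ is a finite set of nonnegative integers. Membership in it can be tested in linear time, in the following sense: given $(\rho,\sigma)$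 and $m\in\mathbb Z$, whether $g(\rho)-h(\sigma)+mF\in g(\mathcal R)$ can be decided in time $O(n)$; and given an arbitrary integer $v$, whether $v\in g(\mathcal R)$ can be decided in time $O(n+\log x)$, which is linear in $n$ for fixed $x,y$. Moreover, for every $(\rho,\sigma)$ there is a unique $m\in\mathbb Z$ with $g(\rho)-h(\sigma)+mF\in g(\mathcal R)$; given $(\rho,\sigma)$, it can be found in time $O(n(1+\log x))$ (that is, $O(n\log x)$ if $x\ge2$ and $O(n)$ if $x=1$); and $$m-\left\lceil\frac{h(\sigma)-g(\rho)}{F}\right\rceil\in\{0,1,\dots,x-1\}.$$ (iii) For all $(\rho,\sigma),(\rho',\sigma')\in\mathcal R\times\Sigma$: $(\rho,\sigma)\sim(\rho',\sigma')$ if and only if $g(\rho)-h(\sigma)=g(\rho')-h(\sigma')$ and $\deg\sigma=\deg\sigma'$. -/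

import Mathlib

namespace RotorRouting

/-! ## Multigraphs with a rotor order -/

/-- A directed multigraph with vertices `V` and arcs `A`, together with a rotor order: a permutation
`rot` of the arcs such that, for each arc `a` with tail `u` of outdegree `k`, the orbit
`a, rot a, …, rot^(k-1) a` is exactly the set of arcs going out of `u`. -/
structure RotorGraph (V A : Type*) where
  head : A → V
  tail : A → V
  rot : Equiv.Perm A
  tail_rot : ∀ a, tail (rot a) = tail a
  orbit_rot : ∀ a, {b | ∃ k < {b | tail b = tail a}.ncard, (rot ^ k) a = b} = {b | tail b = tail a}

section General

variable {V A : Type*} (G : RotorGraph V A)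

/-- The vertices of positive outdegree (those that are not sinks). -/
abbrev RotorGraph.Active : Type _ := {u : V // ∃ a, G.tail a = u}

/-- The arcs going out of `u`. -/
abbrev RotorGraph.OutArc (u : V) : Type _ := {a : A // G.tail a = u}

/-- A rotor configuration chooses an outgoing arc at every vertex that is not a sink. -/
abbrev RotorGraph.RotorConfig : Type _ := ∀ u : G.Active, G.OutArc u.1

/-- A particle configuration: an integer number of particles on every vertex. -/
abbrev ParticleConfig (V : Type*) : Type _ := V → ℤ

/-- A rotor-particle configuration. -/
abbrev RotorGraph.Config : Type _ := G.RotorConfig × ParticleConfig V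

/-- The degree of a particle configuration. -/
def deg {V : Type*} [Fintype V] (σ : ParticleConfig V) : ℤ := ∑ u, σ u

/-- The rotor order restricted to the arcs going out of `u`. -/
def RotorGraph.rotAt (u : V) : Equiv.Perm (G.OutArc u) :=
  G.rot.subtypePerm (p := fun a => G.tail a = u) (fun a => by rw [G.tail_rot])

variable [DecidableEq V]

/-- `move u` transfers one particle from `u` to the head of the rotor at `u`. -/
def RotorGraph.move (u : G.Active) : Equiv.Perm G.Config where
  toFun c := (c.1, c.2 + Pi.single (G.head (c.1 u).1) 1 - Pi.single u.1 1)
  invFun c := (c.1, c.2 - Pi.single (G.head (c.1 u).1) 1 + Pi.single u.1 1)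
  left_inv c := Prod.ext rfl (by simp only; abel)
  right_inv c := Prod.ext rfl (by simp only; abel)

/-- `turn u` advances the rotor at `u` to the next arc. -/
def RotorGraph.turn (u : G.Active) : Equiv.Perm G.Config where
  toFun c := (Function.update c.1 u (G.rotAt u.1 (c.1 u)), c.2)
  invFun c := (Function.update c.1 u ((G.rotAt u.1).symm (c.1 u)), c.2)
  left_inv c := by simp
  right_inv c := by simp

/-- Positive routing at `u`: move, then turn. Its inverse is negative routing at `u`. -/
def RotorGraph.routing (u : G.Active) : Equiv.Perm G.Config := G.turn u * G.move u

theorem RotorGraph.routing_apply (u : G.Active) (c : G.Config) :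
    G.routing u c = (Function.update c.1 u (G.rotAt u.1 (c.1 u)),
      c.2 + Pi.single (G.head (c.1 u).1) 1 - Pi.single u.1 1) := rfl

theorem RotorGraph.routing_commute (u v : G.Active) : Commute (G.routing u) (G.routing v) := by
  by_cases huv : u = v
  · rw [huv]
  · refine Equiv.ext fun c => ?_
    simp only [Equiv.Perm.mul_apply, RotorGraph.routing_apply, ne_eq, huv, Ne.symm huv,
      not_false_eq_true, Function.update_of_ne]
    refine Prod.ext ?_ ?_
    · exact Function.update_comm (Ne.symm huv) _ _ _
    · simp only
      abel

variable [Fintype V] [Fintype A]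

/-- The operator `routing^r` of a routing vector `r`: positive routing at `u` is applied `r u` times
(its inverse `-r u` times when `r u < 0`), for every `u`; the order does not matter. -/
def RotorGraph.routingPow (r : G.Active → ℤ) : Equiv.Perm G.Config :=
  Finset.univ.noncommProd (fun u => G.routing u ^ r u)
    (fun u _ v _ _ => ((G.routing_commute u v).zpow_zpow (r u) (r v)))

/-- Equivalence of rotor-particle configurations: one is routed to the other by a routing vector. -/
def RotorGraph.Equivalent (c c' : G.Config) : Prop :=
  ∃ r : G.Active → ℤ, G.routingPow r c = c'

/-- The full routings of `c`: the configurations obtained by routing `c` that have no particle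
outside the sinks. -/
def RotorGraph.routingInf (c : G.Config) : Set G.Config :=
  {c' | G.Equivalent c c' ∧ ∀ u : G.Active, c'.2 u.1 = 0}

end General

/-! ## The path multigraph -/

/-- The path multigraph `P^{x,y}_n` with vertices `u_0, …, u_{n+1}`. The arc `a^{k+1}_i`
(`k < n`, `i < x + y`) is the pair `(k, i)`: its tail is `u_{k+1}` and its head is `u_{k+2}` if
`i < x` and `u_k` otherwise. The rotor order sends `a^{k+1}_i` to `a^{k+1}_{i + 1 mod x + y}`. -/
def pathGraph (n x y : ℕ) : RotorGraph (Fin (n + 2)) (Fin n × Fin (x + y)) where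
  tail a := a.1.succ.castSucc
  head a := if a.2.1 < x then a.1.succ.succ else a.1.castSucc.castSucc
  rot := Equiv.prodCongr (Equiv.refl _) (finRotate (x + y))
  tail_rot a := rfl
  orbit_rot := by
    rintro ⟨k, i⟩
    have hpow : ∀ j : ℕ, ((Equiv.prodCongr (Equiv.refl (Fin n)) (finRotate (x + y)) ^ j) (k, i))
        = (k, (finRotate (x + y) ^ j) i) := by
      intro j
      induction j with
      | zero => rfl
      | succ j ih => rw [pow_succ', Equiv.Perm.mul_apply, ih, pow_succ']; rfl
    have hset : {b : Fin n × Fin (x + y) | b.1.succ.castSucc = k.succ.castSucc}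
        = (fun j : Fin (x + y) => (k, j)) '' Set.univ := by
      ext ⟨k', j⟩
      simp [eq_comm]
    have hcard : {b : Fin n × Fin (x + y) | b.1.succ.castSucc = k.succ.castSucc}.ncard = x + y := by
      rw [hset, Set.ncard_image_of_injective _ (fun a b h => (Prod.mk.inj h).2), Set.ncard_univ,
        Nat.card_eq_fintype_card, Fintype.card_fin]
    have key : ∀ (N : ℕ) (i j : Fin N), ∃ m < N, (finRotate N ^ m) i = j := by
      intro N i j
      obtain _ | N := N
      · exact i.elim0
      · refine ⟨(j - i).val, (j - i).isLt, ?_⟩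
        have hrot : ∀ m : ℕ, (finRotate (N + 1) ^ m) i = i + Fin.ofNat (N + 1) m := by
          intro m
          induction m with
          | zero => simp
          | succ m ih =>
            rw [pow_succ', Equiv.Perm.mul_apply, ih, finRotate_apply]
            ext
            simp [Fin.val_add, Nat.add_assoc]
        rw [hrot, Fin.ofNat_val_eq_self]
        abel
    rw [hcard]
    ext ⟨k', j⟩
    simp only [hpow, Set.mem_ofPred_eq, Prod.mk.injEq, Fin.castSucc_inj, Fin.succ_inj]
    constructor
    · rintro ⟨_, _, h, _⟩
      exact h.symm
    · rintro rfl
      obtain ⟨m, hm, h⟩ := key (x + y) i j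
      exact ⟨m, hm, rfl, h⟩

/-- `F = ∑_{i=0}^{n} x^{n-i} y^i`. -/
def pathF (n x y : ℕ) : ℕ := ∑ i ∈ Finset.range (n + 1), x ^ (n - i) * y ^ i

/-! ## Algorithms with unit-cost integer arithmetic -/

/-- Integer expressions over registers and arrays. -/
inductive Expr
  | lit (c : ℤ)
  | reg (i : ℕ)
  | get (a : ℕ) (e : Expr)
  | add (e₁ e₂ : Expr)
  | sub (e₁ e₂ : Expr)
  | mul (e₁ e₂ : Expr)
  | div (e₁ e₂ : Expr)
  | mod (e₁ e₂ : Expr)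

/-- Programs: assignments to registers and to array cells, sequencing, and branching and looping
on comparisons `e₁ ≤ e₂`. -/
inductive Program
  | skip
  | set (i : ℕ) (e : Expr)
  | put (a : ℕ) (e₁ e₂ : Expr)
  | seq (p q : Program)
  | ifLe (e₁ e₂ : Expr) (p q : Program)
  | whileLe (e₁ e₂ : Expr) (p : Program)

/-- A memory: register `i` holds `reg i`, and cell `k` of array `a` holds `arr a k`. -/
structure Memory where
  reg : ℕ → ℤ
  arr : ℕ → ℤ → ℤ

/-- The value of an expression (`div` and `mod` are quotient and remainder of integer division). -/
def Expr.eval (s : Memory) : Expr → ℤ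
  | .lit c => c
  | .reg i => s.reg i
  | .get a e => s.arr a (e.eval s)
  | .add e₁ e₂ => e₁.eval s + e₂.eval s
  | .sub e₁ e₂ => e₁.eval s - e₂.eval s
  | .mul e₁ e₂ => e₁.eval s * e₂.eval s
  | .div e₁ e₂ => e₁.eval s / e₂.eval s
  | .mod e₁ e₂ => e₁.eval s % e₂.eval s

/-- The number of elementary operations needed to evaluate an expression. -/
def Expr.cost : Expr → ℕ
  | .lit _ => 1
  | .reg _ => 1
  | .get _ e => e.cost + 1
  | .add e₁ e₂ => e₁.cost + e₂.cost + 1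
  | .sub e₁ e₂ => e₁.cost + e₂.cost + 1
  | .mul e₁ e₂ => e₁.cost + e₂.cost + 1
  | .div e₁ e₂ => e₁.cost + e₂.cost + 1
  | .mod e₁ e₂ => e₁.cost + e₂.cost + 1

/-- `Exec p s s' t`: started in memory `s`, the program `p` halts in memory `s'` after `t`
elementary operations. -/
inductive Exec : Program → Memory → Memory → ℕ → Prop
  | skip (s : Memory) : Exec .skip s s 1
  | set (s : Memory) (i : ℕ) (e : Expr) :
      Exec (.set i e) s ⟨Function.update s.reg i (e.eval s), s.arr⟩ (e.cost + 1)
  | put (s : Memory) (a : ℕ) (e₁ e₂ : Expr) :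
      Exec (.put a e₁ e₂) s
        ⟨s.reg, Function.update s.arr a (Function.update (s.arr a) (e₁.eval s) (e₂.eval s))⟩
        (e₁.cost + e₂.cost + 1)
  | seq {p q : Program} {s s' s'' : Memory} {t t' : ℕ} :
      Exec p s s' t → Exec q s' s'' t' → Exec (.seq p q) s s'' (t + t')
  | ifTrue {e₁ e₂ : Expr} {p q : Program} {s s' : Memory} {t : ℕ} :
      e₁.eval s ≤ e₂.eval s → Exec p s s' t →
      Exec (.ifLe e₁ e₂ p q) s s' (e₁.cost + e₂.cost + 1 + t)
  | ifFalse {e₁ e₂ : Expr} {p q : Program} {s s' : Memory} {t : ℕ} :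
      ¬ e₁.eval s ≤ e₂.eval s → Exec q s s' t →
      Exec (.ifLe e₁ e₂ p q) s s' (e₁.cost + e₂.cost + 1 + t)
  | whileTrue {e₁ e₂ : Expr} {p : Program} {s s' s'' : Memory} {t t' : ℕ} :
      e₁.eval s ≤ e₂.eval s → Exec p s s' t → Exec (.whileLe e₁ e₂ p) s' s'' t' →
      Exec (.whileLe e₁ e₂ p) s s'' (e₁.cost + e₂.cost + 1 + t + t')
  | whileFalse {e₁ e₂ : Expr} {p : Program} {s : Memory} :
      ¬ e₁.eval s ≤ e₂.eval s →
      Exec (.whileLe e₁ e₂ p) s s (e₁.cost + e₂.cost + 1)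

/-- Started in memory `s`, `p` halts within `T` operations with `out` in register `0`. -/
def Program.Computes (p : Program) (s : Memory) (out : ℤ) (T : ℕ) : Prop :=
  ∃ s' t, Exec p s s' t ∧ s'.reg 0 = out ∧ t ≤ T

/-- Started in memory `s`, `p` halts within `T` operations with `1` in register `0` if `φ` holds
and with `0` in register `0` otherwise. -/
def Program.Decides (p : Program) (s : Memory) (φ : Prop) (T : ℕ) : Prop :=
  (φ → p.Computes s 1 T) ∧ (¬ φ → p.Computes s 0 T)

/-- Registers `1, 2, 3, 4` hold `n, x, y, v`; all other registers hold `0`. -/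
def inputRegs (n x y : ℕ) (v : ℤ) : ℕ → ℤ
  | 1 => n
  | 2 => x
  | 3 => y
  | 4 => v
  | _ => 0

/-- The arrays describing `(ρ, σ)`: cell `k` of array `0` holds the index `i` with
`ρ (u_k) = a^k_i`, and cell `k` of array `1` holds `σ (u_k)`; all other cells hold `0`. -/
def inputArrs {n x y : ℕ} (c : (pathGraph n x y).Config) : ℕ → ℤ → ℤ
  | 0 => fun k => ∑ u : (pathGraph n x y).Active,
      if (u.1.val : ℤ) = k then ((c.1 u).1.2.val : ℤ) else 0
  | 1 => fun k => ∑ u : Fin (n + 2), if (u.val : ℤ) = k then c.2 u else 0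
  | _ => fun _ => 0

/-- The memory holding the integer `v`. -/
def inputInt (n x y : ℕ) (v : ℤ) : Memory := ⟨inputRegs n x y v, fun _ _ => 0⟩

/-- The memory holding the rotor-particle configuration `c` and the integer `m`. -/
def inputConfig {n x y : ℕ} (c : (pathGraph n x y).Config) (m : ℤ) : Memory :=
  ⟨inputRegs n x y m, inputArrs c⟩

end RotorRouting

/-!
# Rotor-routing on the path multigraph

Give the edge between `u_k` and `u_{k+1}` the weight `x ^ (n - k) * y ^ k`, so that a unit of one
weight is worth `x / y` units of the next. Let `h σ` sum, over all edges, the weight times the number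
of particles beyond the edge, and let `g ρ` sum the weights of the moves (right moves positive, left
moves negative) that turn the rotors from position `0` to their positions in `ρ`. Then routing
leaves `g ρ - h σ` unchanged: a move is recorded once in `g` and once in `h`, and a full turn of a
rotor has `x` right moves and `y` left moves, which cancel (`pathVal_configCoeff_routing`).
Conversely, as `x` and `y` are coprime, a coefficient vector of value `0` is a combination of the
relations between consecutive weights (`exists_of_pathVal_eq_zero`), and these relations are the full
turns; hence equal invariants imply equivalence (`equivalent_of_invariants_eq`).

Membership in the range of `g` is governed by carry propagation. Write a number as
`∑ k ≤ n, c k * x ^ (n - k) * y ^ k`. It is a value of `g` if and only if there are numbers of right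
and left moves at every vertex, each pair on the staircase described by a turning rotor, whose net
flow over the `k`-th edge is `c k`. From left to right, the possible numbers of left moves form
intervals; their end points, negated, obey the recursion `z (k + 1) = c (k + 1) + x * (z k / y)`,
with `c` for one end point and `c - 1` for (one beyond) the other. So the number is a value of `g` if
and only if `carry` ends nonnegative from `c` and negative from `c - 1` (`exists_rotorCoeff_iff`).

Adding `m * F` to the number adds `m` to all coefficients, and the final carry is strictly increasing
in `m`; so exactly one `m` gives a value of `g`, the place where the final carry changes sign. It is
the number of particles on `u_{n+1}` after a full routing (`routingInf_spec`). The bounds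
`0 ≤ g < x * F` confine it to `x` consecutive integers.

The algorithms follow: two carry propagations decide membership, and a binary search finds `m`. An
arbitrary integer first needs coefficients; they come from an inverse of `y ^ n` modulo `x`, which
the Euclidean algorithm finds in `O(log x)` steps (`pathVal_bezoutCoeff`).
-/

namespace RotorRouting

/-! ### Weighted sums and carry propagation -/

/-- The integer with coefficients `c 0, …, c n` with respect to the weights `x ^ (n - k) * y ^ k`. -/
def pathVal (x y : ℤ) (n : ℕ) (c : ℕ → ℤ) : ℤ :=
  ∑ k ∈ Finset.range (n + 1), c k * (x ^ (n - k) * y ^ k)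

/-- Carry propagation from the coefficient `0` upwards: as `y` units of weight `x ^ (n - k) * y ^ k`
are worth `x` units of the next weight, the quotient by `y` is carried over, and remainders are
dropped. -/
def carry (x y : ℤ) (c : ℕ → ℤ) : ℕ → ℤ
  | 0 => c 0
  | k + 1 => c (k + 1) + x * (carry x y c k / y)

section Arithmetic

variable {x y : ℤ} {n : ℕ} {c : ℕ → ℤ}

theorem pathVal_zero : pathVal x y 0 c = c 0 := by simp [pathVal]

theorem pathVal_succ :
    pathVal x y (n + 1) c = x * pathVal x y n c + c (n + 1) * y ^ (n + 1) := by
  rw [pathVal, Finset.sum_range_succ, pathVal, Finset.mul_sum]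
  congr 1
  · refine Finset.sum_congr rfl fun k hk => ?_
    rw [Nat.succ_sub (by simpa [Nat.lt_succ_iff] using hk), pow_succ]
    ring
  · simp

theorem pathVal_congr {c' : ℕ → ℤ} (h : ∀ k ≤ n, c k = c' k) :
    pathVal x y n c = pathVal x y n c' :=
  Finset.sum_congr rfl fun k hk => by rw [h k (by simpa [Nat.lt_succ_iff] using hk)]

theorem pathVal_add (c c' : ℕ → ℤ) :
    pathVal x y n (fun k => c k + c' k) = pathVal x y n c + pathVal x y n c' := by
  simp [pathVal, add_mul, Finset.sum_add_distrib]

theorem pathVal_sub (c c' : ℕ → ℤ) :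
    pathVal x y n (fun k => c k - c' k) = pathVal x y n c - pathVal x y n c' := by
  simp [pathVal, sub_mul, Finset.sum_sub_distrib]

theorem pathVal_const (m : ℤ) :
    pathVal x y n (fun _ => m) = m * pathVal x y n (fun _ => 1) := by
  simp [pathVal, Finset.mul_sum]

theorem pathVal_add_const (c : ℕ → ℤ) (m : ℤ) :
    pathVal x y n (fun k => c k + m) = pathVal x y n c + m * pathVal x y n (fun _ => 1) := by
  rw [← pathVal_const m, ← pathVal_add]

theorem pathVal_one_pos (hx : 0 < x) (hy : 0 < y) : 0 < pathVal x y n (fun _ => 1) :=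
  Finset.sum_pos (fun k _ => by positivity) (by simp)

theorem pathVal_telescope (s : ℕ → ℤ) :
    pathVal x y n (fun k => x * s k - y * s (k + 1))
      = x ^ (n + 1) * s 0 - y ^ (n + 1) * s (n + 1) := by
  induction n with
  | zero => simp [pathVal_zero]
  | succ n ih => rw [pathVal_succ, ih]; ring

/-- The coefficient vectors of value `0` are the integer combinations of the relations
`x * (x ^ (n - k) * y ^ k) = y * (x ^ (n - k + 1) * y ^ (k - 1))` between consecutive weights. -/
theorem exists_of_pathVal_eq_zero (hx : x ≠ 0) (hxy : IsCoprime x y) (h : pathVal x y n c = 0) :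
    ∃ s : ℕ → ℤ, s 0 = 0 ∧ s (n + 1) = 0 ∧ ∀ k ≤ n, c k = x * s k - y * s (k + 1) := by
  induction n generalizing c with
  | zero => exact ⟨0, rfl, rfl, fun k hk => by simpa [Nat.le_zero.1 hk, pathVal_zero] using h⟩
  | succ n ih =>
    rw [pathVal_succ] at h
    obtain ⟨t, ht⟩ : x ∣ c (n + 1) := by
      refine (hxy.pow_right (n := n + 1)).dvd_of_dvd_mul_right ⟨-pathVal x y n c, ?_⟩
      linarith
    have h' : pathVal x y n (fun k => c k + if k = n then t * y else 0) = 0 := by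
      have h1 : pathVal x y n (fun k => if k = n then t * y else 0) = t * y ^ (n + 1) := by
        rw [pathVal, Finset.sum_eq_single n]
        · simp [pow_succ]; ring
        · intro b _ hb; simp [hb]
        · simp
      rw [pathVal_add, h1]
      refine mul_left_cancel₀ hx ?_
      rw [mul_zero, ← h, ht]; ring
    obtain ⟨s, hs0, hsn, hs⟩ := ih h'
    refine ⟨fun k => if k ≤ n then s k else if k = n + 1 then t else 0, by simpa using hs0,
      by simp, fun k hk => ?_⟩
    rcases hk.lt_or_eq with hk | rfl
    · rcases (Nat.lt_succ_iff.1 hk).lt_or_eq with hk | rfl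
      · have := hs k hk.le
        simp only [hk.ne, if_false, add_zero] at this
        simp [hk.le, Nat.succ_le_of_lt hk, this]
      · have := hs k le_rfl
        simp only [if_true, hsn] at this
        simp
        linarith
    · simp [ht]

theorem carry_mono_of_le {c' : ℕ → ℤ} (hx : 0 ≤ x) (hy : 0 < y) (h : ∀ k, c k ≤ c' k) (k : ℕ) :
    carry x y c k ≤ carry x y c' k := by
  induction k with
  | zero => exact h 0
  | succ k ih =>
    exact add_le_add (h _) (mul_le_mul_of_nonneg_left (Int.ediv_le_ediv hy ih) hx)

theorem carry_strictMono (hx : 0 ≤ x) (hy : 0 < y) (c : ℕ → ℤ) (n : ℕ) :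
    StrictMono fun m : ℤ => carry x y (fun k => c k + m) n := by
  intro m m' hm
  have hle := carry_mono_of_le (c := fun k => c k + m) (c' := fun k => c k + m') hx hy
    (fun k => by linarith)
  cases n with
  | zero => simpa [carry] using hm
  | succ n =>
    have := mul_le_mul_of_nonneg_left (Int.ediv_le_ediv hy (hle n)) hx
    simp only [carry]
    linarith

theorem exists_carry_sign_change (hx : 0 ≤ x) (hy : 0 < y) (c : ℕ → ℤ) (n : ℕ) :
    ∃ m : ℤ, 0 ≤ carry x y (fun k => c k + m) n ∧ carry x y (fun k => c k + (m - 1)) n < 0 := by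
  set f : ℤ → ℤ := fun m => carry x y (fun k => c k + m) n with hf
  have hmono : StrictMono f := carry_strictMono hx hy c n
  have hup : ∀ j : ℕ, f 0 + j ≤ f j := by
    intro j
    induction j with
    | zero => simp
    | succ j ih =>
      have := hmono (show (j : ℤ) < ((j + 1 : ℕ) : ℤ) by push_cast; omega)
      push_cast at this ⊢
      omega
  have hdown : ∀ j : ℕ, f (-j) ≤ f 0 - j := by
    intro j
    induction j with
    | zero => simp
    | succ j ih =>
      have := hmono (show -((j + 1 : ℕ) : ℤ) < -(j : ℤ) by push_cast; omega)
      push_cast at this ⊢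
      omega
  obtain ⟨m, hm, hmin⟩ := Int.exists_least_of_bdd (P := fun m => 0 ≤ f m)
    ⟨-((f 0).natAbs + 1 : ℕ), fun m hm => by
      by_contra hlt
      have h1 := hmono (not_le.1 hlt)
      have h2 := hdown ((f 0).natAbs + 1)
      rw [Nat.cast_add, Nat.cast_one] at h1 h2
      omega⟩
    ⟨(f 0).natAbs, by have := hup (f 0).natAbs; omega⟩
  refine ⟨m, hm, not_le.1 fun h => ?_⟩
  have := hmin (m - 1) h
  omega

/-- A sign change of a strictly monotone function on the integers happens only once. -/
theorem sign_change_unique {f : ℤ → ℤ} (hf : StrictMono f) {m m' : ℤ}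
    (h : 0 ≤ f m ∧ f (m - 1) < 0) (h' : 0 ≤ f m' ∧ f (m' - 1) < 0) : m = m' := by
  have h1 : m - 1 < m' := hf.lt_iff_lt.1 (by linarith [h.2, h'.1])
  have h2 : m' - 1 < m := hf.lt_iff_lt.1 (by linarith [h'.2, h.1])
  omega

/-- The remainders dropped by carry propagation are nonnegative. -/
theorem pow_mul_carry_le (hx : 0 ≤ x) (hy : 0 < y) : y ^ n * carry x y c n ≤ pathVal x y n c := by
  induction n with
  | zero => simp [carry, pathVal_zero]
  | succ n ih =>
    rw [pathVal_succ, carry]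
    have h1 := Int.mul_ediv_self_le (x := carry x y c n) (k := y) hy.ne'
    have h2 : y ^ n * (x * (y * (carry x y c n / y))) ≤ y ^ n * (x * carry x y c n) := by gcongr
    have h3 := mul_le_mul_of_nonneg_left ih hx
    calc y ^ (n + 1) * (c (n + 1) + x * (carry x y c n / y))
        = y ^ n * (x * (y * (carry x y c n / y))) + c (n + 1) * y ^ (n + 1) := by ring
      _ ≤ _ := by linarith

/-- The remainders dropped by carry propagation are at most `y - 1`. -/
theorem pathVal_le_carry (hx : 0 ≤ x) (hy : 0 < y) :
    pathVal x y n c ≤ y ^ n * carry x y c n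
      + (y - 1) * (pathVal x y n (fun _ => 1) - y ^ n) := by
  induction n with
  | zero => simp [carry, pathVal_zero]
  | succ n ih =>
    rw [pathVal_succ, pathVal_succ, carry]
    have h1 := Int.lt_mul_ediv_self_add (x := carry x y c n) (k := y) hy
    have h2 : y ^ n * (x * carry x y c n) ≤ y ^ n * (x * (y * (carry x y c n / y) + (y - 1))) := by
      gcongr; omega
    have h3 := mul_le_mul_of_nonneg_left ih hx
    calc x * pathVal x y n c + c (n + 1) * y ^ (n + 1)
        ≤ x * (y ^ n * carry x y c n + (y - 1) * (pathVal x y n (fun _ => 1) - y ^ n))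
          + c (n + 1) * y ^ (n + 1) := by linarith
      _ ≤ y ^ n * (x * (y * (carry x y c n / y) + (y - 1)))
          + x * ((y - 1) * (pathVal x y n (fun _ => 1) - y ^ n)) + c (n + 1) * y ^ (n + 1) := by
          linarith
      _ = _ := by ring

theorem pathVal_nonneg_of_carry (hx : 0 ≤ x) (hy : 0 < y) (h : 0 ≤ carry x y c n) :
    0 ≤ pathVal x y n c :=
  (mul_nonneg (by positivity) h).trans (pow_mul_carry_le hx hy)

theorem pathVal_lt_of_carry (hx : 0 < x) (hy : 0 < y)
    (h : carry x y (fun k => c k + -1) n < 0) :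
    pathVal x y n c < x * pathVal x y n (fun _ => 1) := by
  have h1 := pathVal_le_carry (c := fun k => c k + -1) (n := n) hx.le hy
  rw [pathVal_add_const] at h1
  have h2 : y ^ n * carry x y (fun k => c k + -1) n ≤ y ^ n * (-1) := by gcongr; omega
  have h3 := pathVal_telescope (x := x) (y := y) (n := n) (fun _ => -1)
  rw [pathVal_const] at h3
  have h4 : 0 < x ^ (n + 1) := by positivity
  rw [pow_succ y] at h3
  linarith

/-! ### Rotor positions as lattice points on a staircase -/

/-- The number of right moves among the first `i ≤ x + y` moves of a rotor that starts at
position `0`. The number of left moves is `i - rightMoves x i`. -/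
def rightMoves (x i : ℤ) : ℤ := min i x

/-- The coefficients of `g ρ`, where `i k` is the position of the rotor at `u_k`. -/
def rotorCoeff (x : ℤ) (i : ℕ → ℤ) (k : ℕ) : ℤ :=
  rightMoves x (i k) - (i (k + 1) - rightMoves x (i (k + 1)))

/-- The pairs (left moves, right moves), taken with a minus sign, of a rotor that has been turned
from position `0` any integer number of times are the lattice points of a staircase with steps of
width `y` and height `x`. -/
theorem exists_position_iff (hx : 0 < x) (hy : 0 < y) (D E : ℤ) :
    (∃ i t : ℤ, 0 ≤ i ∧ i < x + y ∧ D = -(i - rightMoves x i + y * t)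
        ∧ E = -(rightMoves x i + x * t)) ↔
      x * ((D - 1) / y) ≤ E ∧ E ≤ x * (D / y) := by
  constructor
  · rintro ⟨i, t, hi, hi', rfl, rfl⟩
    rcases le_or_gt i x with h | h
    · have e1 : -(i - rightMoves x i + y * t) / y = -t := by
        rw [rightMoves, min_eq_left h]
        exact Int.ediv_eq_of_eq_mul_right hy.ne' (by ring)
      have e2 : (-(i - rightMoves x i + y * t) - 1) / y = -t - 1 := by
        rw [rightMoves, min_eq_left h, Int.ediv_eq_iff_of_pos hy]
        constructor <;> linarith
      rw [e1, e2, rightMoves, min_eq_left h]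
      constructor <;> linarith
    · have e1 : -(i - rightMoves x i + y * t) / y = -t - 1 := by
        rw [rightMoves, min_eq_right h.le, Int.ediv_eq_iff_of_pos hy]
        constructor <;> linarith
      have e2 : (-(i - rightMoves x i + y * t) - 1) / y = -t - 1 := by
        rw [rightMoves, min_eq_right h.le, Int.ediv_eq_iff_of_pos hy]
        constructor <;> linarith
      rw [e1, e2, rightMoves, min_eq_right h.le]
      constructor <;> linarith
  · rintro ⟨h1, h2⟩
    have hr := Int.emod_nonneg D hy.ne'
    have hr' := Int.emod_lt_of_pos D hy
    have hD := Int.mul_ediv_add_emod D y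
    rcases hr.eq_or_lt with h0 | h0
    · have e2 : (D - 1) / y = D / y - 1 := by
        rw [Int.ediv_eq_iff_of_pos hy]
        constructor <;> linarith
      rw [e2] at h1
      refine ⟨x * (D / y) - E, -(D / y), by linarith, by linarith, ?_, ?_⟩ <;>
        rw [rightMoves, min_eq_left (by linarith)] <;> linarith
    · have e2 : (D - 1) / y = D / y := by
        rw [Int.ediv_eq_iff_of_pos hy]
        constructor <;> linarith
      rw [e2] at h1
      refine ⟨x + (y - D % y), -(D / y) - 1, by linarith, by linarith, ?_, ?_⟩ <;>
        rw [rightMoves, min_eq_right (by linarith)] <;> linarith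

/-- Moving a lattice point through an interval `[a, b]` lets its vertical range on the staircase sweep
a whole interval: the ranges of consecutive points touch. -/
theorem exists_staircase_step_iff (hx : 0 ≤ x) (hy : 0 < y) {a b : ℤ} (hab : a ≤ b) (E : ℤ) :
    (∃ D, a ≤ D ∧ D ≤ b ∧ x * ((D - 1) / y) ≤ E ∧ E ≤ x * (D / y)) ↔
      x * ((a - 1) / y) ≤ E ∧ E ≤ x * (b / y) := by
  constructor
  · rintro ⟨D, h1, h2, h3, h4⟩
    exact ⟨(mul_le_mul_of_nonneg_left (Int.ediv_le_ediv hy (by linarith)) hx).trans h3,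
      h4.trans (mul_le_mul_of_nonneg_left (Int.ediv_le_ediv hy h2) hx)⟩
  · rintro ⟨h1, h2⟩
    induction b, hab using Int.leInduction with
    | base => exact ⟨a, le_rfl, le_rfl, h1, h2⟩
    | succ b hab ih =>
      rcases le_total E (x * (b / y)) with h | h
      · obtain ⟨D, h3, h4, h5⟩ := ih h
        exact ⟨D, h3, by linarith, h5⟩
      · exact ⟨b + 1, by linarith, le_rfl, by simpa using h, h2⟩

/-- Along a path of staircases started at `c 0`, the reachable end points are the integers between
two carry propagations. -/
theorem exists_staircase_path_iff (hx : 0 ≤ x) (hy : 0 < y) (c : ℕ → ℤ) (n : ℕ) (e : ℤ) :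
    (∃ D : ℕ → ℤ, D 0 = c 0 ∧ (∀ k < n, x * ((D k - 1) / y) ≤ D (k + 1) - c (k + 1) ∧
        D (k + 1) - c (k + 1) ≤ x * (D k / y)) ∧ D n = e) ↔
      carry x y (fun k => c k + -1) n < e ∧ e ≤ carry x y c n := by
  induction n generalizing e with
  | zero =>
    simp only [carry]
    constructor
    · rintro ⟨D, h0, -, rfl⟩; omega
    · intro h; exact ⟨fun _ => c 0, rfl, by simp, by simp only; omega⟩
  | succ n ih =>
    have hlt : carry x y (fun k => c k + -1) n < carry x y c n := by
      simpa using carry_strictMono hx hy c n (show (-1 : ℤ) < 0 by norm_num)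
    have key := exists_staircase_step_iff (x := x) hx hy (Int.add_one_le_of_lt hlt) (e - c (n + 1))
    rw [add_sub_cancel_right] at key
    have : (carry x y (fun k => c k + -1) (n + 1) < e ∧ e ≤ carry x y c (n + 1)) ↔
        (x * (carry x y (fun k => c k + -1) n / y) ≤ e - c (n + 1) ∧
          e - c (n + 1) ≤ x * (carry x y c n / y)) := by
      simp only [carry]
      constructor <;> rintro ⟨h1, h2⟩ <;> constructor <;> linarith
    rw [this, ← key]
    constructor
    · rintro ⟨D, h0, h, rfl⟩
      have := (ih (D n)).1 ⟨D, h0, fun k hk => h k (hk.trans n.lt_succ_self), rfl⟩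
      exact ⟨D n, Int.add_one_le_of_lt this.1, this.2, h n n.lt_succ_self⟩
    · rintro ⟨d, h1, h2, h3⟩
      obtain ⟨D, h0, h, rfl⟩ := (ih d).2 ⟨Int.lt_of_add_one_le h1, h2⟩
      refine ⟨fun k => if k ≤ n then D k else e, by simpa using h0, fun k hk => ?_, by simp⟩
      rcases (Nat.lt_succ_iff.1 hk).lt_or_eq with hk | rfl
      · simpa [hk.le, Nat.succ_le_of_lt hk] using h k hk
      · simpa using h3

/-- The value of a coefficient vector `c` is the value of a rotor configuration if and only if
carry propagation ends nonnegative from `c` and negative from `c - 1`. -/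
theorem exists_rotorCoeff_iff (hx : 0 < x) (hy : 0 < y) (hxy : IsCoprime x y) :
    (∃ i : ℕ → ℤ, (∀ k, 0 ≤ i k ∧ i k < x + y) ∧ i 0 = 0 ∧ i (n + 1) = 0 ∧
        pathVal x y n (rotorCoeff x i) = pathVal x y n c) ↔
      0 ≤ carry x y c n ∧ carry x y (fun k => c k + -1) n < 0 := by
  rw [and_comm, ← exists_staircase_path_iff hx.le hy]
  have hR0 : rightMoves x 0 = 0 := min_eq_left hx.le
  constructor
  · rintro ⟨i, hi, hi0, hin, h⟩
    obtain ⟨s, hs0, hsn, hs⟩ := exists_of_pathVal_eq_zero (n := n)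
      (c := fun k => c k - rotorCoeff x i k) hx.ne' hxy (by rw [pathVal_sub, h, sub_self])
    simp only [rotorCoeff] at hs
    -- The path is formed by the negated numbers of left moves.
    refine ⟨fun k => -(i (k + 1) - rightMoves x (i (k + 1)) + y * s (k + 1)), ?_, ?_, ?_⟩
    · have := hs 0 n.zero_le
      rw [hi0, hs0, hR0] at this
      simp only [zero_add] at this ⊢
      linarith
    · intro k hk
      refine (exists_position_iff hx hy _ _).1
        ⟨i (k + 1), s (k + 1), (hi _).1, (hi _).2, rfl, ?_⟩
      have := hs (k + 1) hk
      simp only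
      linarith
    · simp [hin, hsn, hR0]
  · rintro ⟨D, hD0, hD, hDn⟩
    choose! i t hi0 hi1 hi2 hi3 using fun k (hk : k < n) =>
      (exists_position_iff hx hy (D k) (D (k + 1) - c (k + 1))).2 (hD k hk)
    set j : ℕ → ℤ := fun k => if 1 ≤ k ∧ k ≤ n then i (k - 1) else 0 with hj
    set s : ℕ → ℤ := fun k => if 1 ≤ k ∧ k ≤ n then t (k - 1) else 0 with hs
    have hj0 : j 0 = 0 := by simp [hj]
    have hs0 : s 0 = 0 := by simp [hs]
    have hjn : j (n + 1) = 0 := by simp [hj]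
    have hsn : s (n + 1) = 0 := by simp [hs]
    have hjs : ∀ k < n, j (k + 1) = i k ∧ s (k + 1) = t k := fun k hk => by
      simp [hj, hs, Nat.succ_le_of_lt hk]
    have hright : ∀ k ≤ n, D k = c k - (rightMoves x (j k) + x * s k) := by
      intro k hk
      cases k with
      | zero => rw [hj0, hs0, hR0, hD0]; ring
      | succ k => rw [(hjs k hk).1, (hjs k hk).2]; linarith [hi3 k hk]
    have hleft : ∀ k ≤ n,
        D k = -(j (k + 1) - rightMoves x (j (k + 1)) + y * s (k + 1)) := by
      intro k hk
      rcases hk.lt_or_eq with hk | rfl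
      · rw [(hjs k hk).1, (hjs k hk).2]; exact hi2 k hk
      · rw [hjn, hsn, hR0, hDn]; ring
    refine ⟨j, fun k => ?_, hj0, hjn, ?_⟩
    · simp only [hj]
      split_ifs with hk
      · exact ⟨hi0 _ (by omega), hi1 _ (by omega)⟩
      · exact ⟨le_rfl, by linarith⟩
    · have h1 : pathVal x y n c = pathVal x y n
          (fun k => rotorCoeff x j k + (x * s k - y * s (k + 1))) := by
        refine pathVal_congr fun k hk => ?_
        rw [rotorCoeff]
        linarith [hright k hk, hleft k hk]
      rw [h1, pathVal_add, pathVal_telescope, hs0, hsn]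
      ring

end Arithmetic

/-! ### Equivalence of configurations -/

section General

variable {V A : Type*} [DecidableEq V] [Fintype V] [Fintype A] (G : RotorGraph V A)

theorem RotorGraph.routingPow_zero : G.routingPow 0 = 1 :=
  (Finset.noncommProd_eq_pow_card _ _ _ 1 fun _ _ => zpow_zero _).trans (one_pow _)

theorem RotorGraph.routingPow_add (r s : G.Active → ℤ) :
    G.routingPow (r + s) = G.routingPow r * G.routingPow s := by
  have hc : ∀ (r s : G.Active → ℤ) (u v : G.Active), Commute (G.routing u ^ r u) (G.routing v ^ s v) :=
    fun r s u v => (G.routing_commute u v).zpow_zpow (r u) (s v)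
  simp only [RotorGraph.routingPow, Pi.add_apply, zpow_add]
  exact Finset.noncommProd_mul_distrib (s := Finset.univ) (fun u => G.routing u ^ r u)
    (fun u => G.routing u ^ s u) (fun u _ v _ _ => hc r r u v) (fun u _ v _ _ => hc s s u v)
    (fun u _ v _ _ => hc s r u v)

theorem RotorGraph.routingPow_single (u : G.Active) (k : ℤ) :
    G.routingPow (Pi.single u k) = G.routing u ^ k := by
  rw [RotorGraph.routingPow]
  have h : ∀ v ∈ Finset.univ.erase u, G.routing v ^ (Pi.single u k : G.Active → ℤ) v = 1 := by
    intro v hv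
    rw [Pi.single_eq_of_ne (Finset.ne_of_mem_erase hv), zpow_zero]
  refine (Finset.mul_noncommProd_erase _ (Finset.mem_univ u) _ _).symm.trans
    ((congrArg _ (Finset.noncommProd_eq_pow_card _ _ _ 1 h)).trans ?_)
  rw [one_pow, mul_one, Pi.single_eq_same]

variable {G}

theorem RotorGraph.Equivalent.refl (c : G.Config) : G.Equivalent c c :=
  ⟨0, by rw [G.routingPow_zero]; rfl⟩

theorem RotorGraph.Equivalent.trans {c c' c'' : G.Config} (h : G.Equivalent c c')
    (h' : G.Equivalent c' c'') : G.Equivalent c c'' := by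
  obtain ⟨r, rfl⟩ := h
  obtain ⟨s, rfl⟩ := h'
  exact ⟨s + r, by rw [G.routingPow_add]; rfl⟩

theorem RotorGraph.Equivalent.symm {c c' : G.Config} (h : G.Equivalent c c') :
    G.Equivalent c' c := by
  obtain ⟨r, rfl⟩ := h
  exact ⟨-r, by rw [← Equiv.Perm.mul_apply, ← G.routingPow_add, neg_add_cancel,
    G.routingPow_zero]; rfl⟩

theorem RotorGraph.equivalent_zpow (u : G.Active) (k : ℤ) (c : G.Config) :
    G.Equivalent c ((G.routing u ^ k) c) :=
  ⟨Pi.single u k, by rw [G.routingPow_single]⟩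

theorem RotorGraph.Equivalent.invariant {β : Type*} {f : G.Config → β}
    (hf : ∀ u c, f (G.routing u c) = f c) {c c' : G.Config} (h : G.Equivalent c c') :
    f c = f c' := by
  obtain ⟨r, rfl⟩ := h
  let S : Subgroup (Equiv.Perm G.Config) :=
    { carrier := {π | ∀ c, f (π c) = f c}
      one_mem' := fun c => rfl
      mul_mem' := fun {π π'} h h' c => (h (π' c)).trans (h' c)
      inv_mem' := fun {π} h c => by rw [← h (π⁻¹ c)]; simp }
  have : G.routingPow r ∈ S :=
    Subgroup.noncommProd_mem S _ fun u _ => S.zpow_mem (show G.routing u ∈ S from hf u) _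
  exact (this c).symm

end General

/-! ### The invariants of the path multigraph -/

section Path

variable {n x y : ℕ}

/-- The vertex `u_{k+1}` of the path, for `k < n`, as a vertex that is not a sink. -/
def pathActive (hN : 0 < x + y) (k : Fin n) : (pathGraph n x y).Active :=
  ⟨k.succ.castSucc, (k, ⟨0, hN⟩), rfl⟩

/-- The arc `a^{k+1}_i` as an arc going out of `u_{k+1}`. -/
def pathArc (hN : 0 < x + y) (k : Fin n) (i : Fin (x + y)) :
    (pathGraph n x y).OutArc (pathActive hN k).1 :=
  ⟨(k, i), rfl⟩

/-- The index `i` with `ρ (u_k) = a^k_i`; it is `0` if `u_k` is a sink or not a vertex. -/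
def position (ρ : (pathGraph n x y).RotorConfig) (k : ℤ) : ℤ :=
  ∑ u : (pathGraph n x y).Active, if (u.1.val : ℤ) = k then ((ρ u).1.2.val : ℤ) else 0

/-- The number of particles beyond `u_k`, that is, on `u_{k+1}, …, u_{n+1}`. -/
def tailSum (σ : ParticleConfig (Fin (n + 2))) (k : ℕ) : ℤ :=
  ∑ u : Fin (n + 2), if k < u.val then σ u else 0

theorem tailSum_last (σ : ParticleConfig (Fin (n + 2))) : tailSum σ (n + 1) = 0 :=
  Finset.sum_eq_zero fun u _ => if_neg (by omega)

theorem tailSum_add (σ τ : ParticleConfig (Fin (n + 2))) (k : ℕ) :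
    tailSum (σ + τ) k = tailSum σ k + tailSum τ k := by
  simp only [tailSum, ← Finset.sum_add_distrib]
  exact Finset.sum_congr rfl fun u _ => by split_ifs <;> simp

theorem tailSum_smul (m : ℤ) (σ : ParticleConfig (Fin (n + 2))) (k : ℕ) :
    tailSum (m • σ) k = m * tailSum σ k := by
  simp only [tailSum, Finset.mul_sum]
  exact Finset.sum_congr rfl fun u _ => by split_ifs <;> simp

theorem tailSum_sub (σ τ : ParticleConfig (Fin (n + 2))) (k : ℕ) :
    tailSum (σ - τ) k = tailSum σ k - tailSum τ k := by
  simp only [tailSum, ← Finset.sum_sub_distrib]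
  exact Finset.sum_congr rfl fun u _ => by split_ifs <;> simp

theorem tailSum_single (v : Fin (n + 2)) (m : ℤ) (k : ℕ) :
    tailSum (Pi.single v m) k = if k < v.val then m else 0 := by
  rw [tailSum, Finset.sum_eq_single v]
  · simp
  · intro b _ hb; simp [hb]
  · simp

/-- The linear function `h`. Its value on a particle at `u_j` is
`∑ k < j, x ^ (n - k) * y ^ k`, a harmonic function of `u_j`. -/
def particleVal (n x y : ℕ) : ParticleConfig (Fin (n + 2)) →ₗ[ℤ] ℤ where
  toFun σ := pathVal x y n (tailSum σ)
  map_add' σ τ := by rw [← pathVal_add]; simp only [← tailSum_add]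
  map_smul' m σ := by
    simp only [pathVal, tailSum_smul, Finset.mul_sum, mul_assoc, smul_eq_mul, RingHom.id_apply]

/-- The function `g`: the rotor at `u_k` contributes `x ^ (n - k) * y ^ k` for every right move and
`-x ^ (n - k + 1) * y ^ (k - 1)` for every left move that brings it from position `0` to its
position. -/
def rotorVal (n x y : ℕ) (ρ : (pathGraph n x y).RotorConfig) : ℤ :=
  pathVal x y n (rotorCoeff x fun k => position ρ k)

/-- Coefficients of `g ρ - h σ`. -/
def configCoeff (c : (pathGraph n x y).Config) (k : ℕ) : ℤ :=
  rotorCoeff x (fun k => position c.1 k) k - tailSum c.2 k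

theorem pathVal_one : pathVal x y n (fun _ => 1) = pathF n x y := by
  simp [pathVal, pathF]

theorem pathVal_configCoeff (c : (pathGraph n x y).Config) :
    pathVal x y n (configCoeff c) = rotorVal n x y c.1 - particleVal n x y c.2 := by
  rw [rotorVal, particleVal]
  exact pathVal_sub _ _

theorem pathVal_configCoeff_add (c : (pathGraph n x y).Config) (m : ℤ) :
    pathVal x y n (fun k => configCoeff c k + m)
      = rotorVal n x y c.1 - particleVal n x y c.2 + m * pathF n x y := by
  rw [pathVal_add_const, pathVal_configCoeff, pathVal_one]

theorem exists_eq_pathActive (hN : 0 < x + y) (u : (pathGraph n x y).Active) :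
    ∃ k, u = pathActive hN k := by
  obtain ⟨u, ⟨k, i⟩, rfl⟩ := u
  exact ⟨k, rfl⟩

theorem outArc_ext (u : (pathGraph n x y).Active) {a b : (pathGraph n x y).OutArc u.1}
    (h : a.1.2 = b.1.2) : a = b := by
  obtain ⟨⟨k, i⟩, ha⟩ := a
  obtain ⟨⟨k', i'⟩, hb⟩ := b
  have : k = k' := by simpa [pathGraph] using ha.trans hb.symm
  subst this
  exact Subtype.ext (Prod.ext rfl h)

theorem outArc_eq_pathArc (hN : 0 < x + y) (k : Fin n)
    (a : (pathGraph n x y).OutArc (pathActive hN k).1) : a = pathArc hN k a.1.2 :=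
  outArc_ext _ rfl

theorem position_succ (hN : 0 < x + y) (ρ : (pathGraph n x y).RotorConfig) (k : Fin n) :
    position ρ (k + 1 : ℕ) = ((ρ (pathActive hN k)).1.2.val : ℤ) := by
  rw [position, Finset.sum_eq_single (pathActive hN k)]
  · simp [pathActive]
  · intro u _ hu
    obtain ⟨k', rfl⟩ := exists_eq_pathActive hN u
    rw [if_neg]
    intro h
    refine hu (congrArg _ (Fin.ext ?_))
    simp [pathActive] at h
    omega
  · simp

theorem position_of_sink (ρ : (pathGraph n x y).RotorConfig) {k : ℕ} (hk : k = 0 ∨ n < k) :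
    position ρ k = 0 := by
  refine Finset.sum_eq_zero fun u _ => if_neg fun h => ?_
  obtain ⟨u, ⟨j, i⟩, rfl⟩ := u
  simp [pathGraph] at h
  omega

theorem position_mem (hN : 0 < x + y) (ρ : (pathGraph n x y).RotorConfig) (k : ℕ) :
    0 ≤ position ρ k ∧ position ρ k < x + y := by
  by_cases hk : k = 0 ∨ n < k
  · rw [position_of_sink ρ hk]; omega
  · obtain ⟨k, rfl⟩ := Nat.exists_eq_succ_of_ne_zero (not_or.1 hk).1
    have h := position_succ hN ρ ⟨k, by omega⟩
    simp only at h
    rw [Nat.succ_eq_add_one, h]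
    omega

theorem routing_pathActive (hN : 0 < x + y) (k : Fin n) (i : Fin (x + y))
    (c : (pathGraph n x y).Config) (hi : c.1 (pathActive hN k) = pathArc hN k i) :
    (pathGraph n x y).routing (pathActive hN k) c =
      (Function.update c.1 (pathActive hN k) (pathArc hN k (finRotate _ i)),
        c.2 + Pi.single (if i.val < x then k.succ.succ else k.castSucc.castSucc) 1
          - Pi.single k.succ.castSucc 1) := by
  rw [RotorGraph.routing_apply, hi]
  rfl

theorem finRotate_val {N : ℕ} (i : Fin N) :
    (finRotate N i).val = if i.val + 1 = N then 0 else i.val + 1 := by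
  obtain _ | N := N
  · exact i.elim0
  · rw [coe_finRotate]
    simp [Fin.ext_iff]

/-- Routing changes the coefficients of `g ρ - h σ` only by a multiple of the relation between two
consecutive weights. -/
theorem pathVal_configCoeff_routing (hN : 0 < x + y) (hy : 0 < y)
    (u : (pathGraph n x y).Active) (c : (pathGraph n x y).Config) :
    pathVal x y n (configCoeff ((pathGraph n x y).routing u c))
      = pathVal x y n (configCoeff c) := by
  obtain ⟨k, rfl⟩ := exists_eq_pathActive hN u
  set i := (c.1 (pathActive hN k)).1.2 with hi
  have hci := outArc_eq_pathArc hN k (c.1 (pathActive hN k))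
  rw [← hi] at hci
  set c' := (pathGraph n x y).routing (pathActive hN k) c with hc'
  have hrt := routing_pathActive hN k i c hci
  rw [← hc'] at hrt
  have hrt1 := congrArg Prod.fst hrt
  have hrt2 := congrArg Prod.snd hrt
  simp only at hrt1 hrt2
  have hpos : position c'.1 (k + 1 : ℕ) = ((finRotate _ i).val : ℤ) := by
    rw [position_succ hN, hrt1, Function.update_self]; rfl
  have hpos' : position c.1 (k + 1 : ℕ) = (i.val : ℤ) := position_succ hN _ _
  have hne : ∀ j : ℕ, j ≠ k + 1 → position c'.1 j = position c.1 j := by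
    intro j hj
    by_cases hjs : j = 0 ∨ n < j
    · rw [position_of_sink _ hjs, position_of_sink _ hjs]
    · obtain ⟨j, rfl⟩ := Nat.exists_eq_succ_of_ne_zero (not_or.1 hjs).1
      have h1 := position_succ hN c'.1 ⟨j, by omega⟩
      have h2 := position_succ hN c.1 ⟨j, by omega⟩
      simp only at h1 h2
      rw [Nat.succ_eq_add_one, h1, h2, hrt1, Function.update_of_ne]
      intro h
      simp [pathActive, Fin.ext_iff] at h
      omega
  have htail : ∀ j, tailSum c'.2 j = tailSum c.2 j
      + (if i.val < x then (if j = k + 1 then 1 else 0) else (if j = k.val then -1 else 0)) := by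
    intro j
    rw [hrt2]
    simp only [tailSum_sub, tailSum_add, tailSum_single]
    split_ifs <;> simp at * <;> omega
  -- Only the step of the rotor from the last position back to `0` changes the coefficients.
  let s : ℕ → ℤ := fun j => if j = k + 1 ∧ i.val + 1 = x + y then -1 else 0
  have hs0 : s 0 = 0 := by simp [s]
  have hsn : s (n + 1) = 0 := by
    have := k.isLt
    simp [s]; omega
  have hrot := finRotate_val i
  have key : ∀ j, configCoeff c' j = configCoeff c j + (x * s j - y * s (j + 1)) := by
    intro j
    simp only [configCoeff, rotorCoeff, htail, rightMoves]
    have hil := i.isLt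
    by_cases hj : j = k + 1
    · subst hj
      rw [hpos, hpos', hne (k + 1 + 1) (by omega), hrot]
      simp only [s]
      by_cases hw : i.val + 1 = x + y
      · have : ¬ i.val < x := by omega
        simp [hw, this]
        omega
      · simp only [hw, if_false, and_false, mul_zero]
        push_cast
        split_ifs <;> omega
    · rw [hne j hj]
      by_cases hj' : j = k.val
      · subst hj'
        rw [hpos, hpos', hrot]
        simp only [s]
        by_cases hw : i.val + 1 = x + y
        · have : ¬ i.val < x := by omega
          simp [hw, this]
          omega
        · simp only [hw, if_false, and_false, mul_zero]
          push_cast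
          split_ifs <;> omega
      · rw [hne (j + 1) (by omega)]
        simp [s, hj, hj']
  rw [show configCoeff c' = fun j => configCoeff c j + (x * s j - y * s (j + 1)) from funext key,
    pathVal_add, pathVal_telescope, hs0, hsn]
  ring

theorem deg_add (σ τ : ParticleConfig (Fin (n + 2))) : deg (σ + τ) = deg σ + deg τ :=
  Finset.sum_add_distrib

theorem deg_sub (σ τ : ParticleConfig (Fin (n + 2))) : deg (σ - τ) = deg σ - deg τ :=
  Finset.sum_sub_distrib _ _

theorem deg_single (v : Fin (n + 2)) (m : ℤ) : deg (Pi.single v m : Fin (n + 2) → ℤ) = m := by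
  simp [deg]

/-- The first half of the classification: `g - h` and the degree are invariants. -/
theorem invariants_eq_of_equivalent (hN : 0 < x + y) (hy : 0 < y)
    {c c' : (pathGraph n x y).Config} (h : (pathGraph n x y).Equivalent c c') :
    pathVal x y n (configCoeff c) = pathVal x y n (configCoeff c') ∧ deg c.2 = deg c'.2 :=
  ⟨h.invariant (f := fun c => pathVal x y n (configCoeff c))
      (pathVal_configCoeff_routing hN hy),
    h.invariant (f := fun c => deg c.2) fun u c => by
      rw [RotorGraph.routing_apply]
      simp only [deg_sub, deg_add, deg_single]
      ring⟩

/-! ### Configurations with equal invariants are equivalent -/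

/-- The rotor configuration with all rotors at position `0`. -/
noncomputable def zeroRotor (n : ℕ) (hN : 0 < x + y) : (pathGraph n x y).RotorConfig := fun u =>
  ⟨(u.2.choose.1, ⟨0, hN⟩), u.2.choose_spec⟩

theorem zeroRotor_pathActive (hN : 0 < x + y) (k : Fin n) :
    zeroRotor n hN (pathActive hN k) = pathArc hN k ⟨0, hN⟩ :=
  outArc_ext _ rfl

theorem exists_equivalent_update_zeroRotor (hN : 0 < x + y) (u : (pathGraph n x y).Active)
    (c : (pathGraph n x y).Config) :
    ∃ τ, (pathGraph n x y).Equivalent c (Function.update c.1 u (zeroRotor n hN u), τ) := by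
  obtain ⟨k, rfl⟩ := exists_eq_pathActive hN u
  obtain ⟨d, hd⟩ : ∃ d, d = x + y - (c.1 (pathActive hN k)).1.2.val := ⟨_, rfl⟩
  induction d using Nat.strong_induction_on generalizing c with
  | _ d ih =>
    set i := (c.1 (pathActive hN k)).1.2 with hi
    have hci := outArc_eq_pathArc hN k (c.1 (pathActive hN k))
    rw [← hi] at hci
    have hrt := routing_pathActive hN k i c hci
    have hstep := RotorGraph.equivalent_zpow (pathActive hN k) 1 c
    rw [zpow_one, hrt] at hstep
    have hil := i.isLt
    by_cases hw : i.val + 1 = x + y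
    · refine ⟨c.2 + Pi.single (if i.val < x then k.succ.succ else k.castSucc.castSucc) 1
          - Pi.single k.succ.castSucc 1, ?_⟩
      rw [zeroRotor_pathActive, show (⟨0, hN⟩ : Fin (x + y)) = finRotate _ i from
        Fin.ext (by rw [finRotate_val, if_pos hw])]
      exact hstep
    · have hlt : x + y - (finRotate _ i).val < d := by
        rw [hd, finRotate_val, if_neg hw]
        omega
      obtain ⟨τ, hτ⟩ := ih _ hlt (Function.update c.1 (pathActive hN k)
        (pathArc hN k (finRotate _ i)), c.2 + Pi.single (if i.val < x then k.succ.succ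
          else k.castSucc.castSucc) 1 - Pi.single k.succ.castSucc 1)
        (by simp only [Function.update_self]; rfl)
      refine ⟨τ, hstep.trans ?_⟩
      simpa only [Function.update_idem] using hτ

theorem exists_equivalent_zeroRotor (hN : 0 < x + y) (c : (pathGraph n x y).Config) :
    ∃ τ, (pathGraph n x y).Equivalent c (zeroRotor n hN, τ) := by
  have key : ∀ S : Finset (pathGraph n x y).Active, ∃ c', (pathGraph n x y).Equivalent c c' ∧
      ∀ u ∈ S, c'.1 u = zeroRotor n hN u := by
    intro S
    induction S using Finset.induction_on with
    | empty => exact ⟨c, .refl c, by simp⟩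
    | insert u S _ ih =>
      obtain ⟨c', hc', h⟩ := ih
      obtain ⟨τ, hτ⟩ := exists_equivalent_update_zeroRotor hN u c'
      refine ⟨_, hc'.trans hτ, fun v hv => ?_⟩
      by_cases hvu : v = u
      · subst hvu; simp
      · exact (Function.update_of_ne hvu _ _).trans
          (h v ((Finset.mem_insert.1 hv).resolve_left hvu))
  obtain ⟨⟨ρ, τ⟩, h, h'⟩ := key Finset.univ
  obtain rfl : ρ = zeroRotor n hN := funext fun u => h' u (Finset.mem_univ u)
  exact ⟨τ, h⟩

/-- The effect on the particles of a full turn of the rotor at `u_{k+1}`. -/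
def fullTurn (x y : ℕ) (k : Fin n) : ParticleConfig (Fin (n + 2)) :=
  Pi.single k.succ.succ (x : ℤ) + Pi.single k.castSucc.castSucc (y : ℤ)
    - Pi.single k.succ.castSucc (x + y : ℤ)

theorem routing_pow_zeroRotor (hN : 0 < x + y) (k : Fin n) (τ : ParticleConfig (Fin (n + 2)))
    (j : ℕ) (hj : j < x + y) :
    ((pathGraph n x y).routing (pathActive hN k) ^ j) (zeroRotor n hN, τ) =
      (Function.update (zeroRotor n hN) (pathActive hN k) (pathArc hN k ⟨j, hj⟩),
        τ + Pi.single k.succ.succ (min (j : ℤ) x)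
          + Pi.single k.castSucc.castSucc (j - min (j : ℤ) x)
          - Pi.single k.succ.castSucc (j : ℤ)) := by
  induction j with
  | zero =>
    rw [← zeroRotor_pathActive, Function.update_eq_self]
    simp
  | succ j ih =>
    rw [pow_succ', Equiv.Perm.mul_apply, ih (by omega),
      routing_pathActive hN k ⟨j, by omega⟩ _ (by simp)]
    refine Prod.ext ?_ ?_
    · simp only [Function.update_idem]
      congr 2
      exact Fin.ext (by rw [finRotate_val, if_neg (by simp only; omega)])
    · simp only
      by_cases h : j < x
      · have e1 : min ((j + 1 : ℕ) : ℤ) x = min (j : ℤ) x + 1 := by omega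
        have e2 : ((j + 1 : ℕ) : ℤ) - (min (j : ℤ) x + 1) = j - min (j : ℤ) x := by omega
        rw [if_pos h, e1, e2, Nat.cast_succ, Pi.single_add, Pi.single_add]
        abel
      · have e1 : min ((j + 1 : ℕ) : ℤ) x = min (j : ℤ) x := by omega
        have e2 : ((j + 1 : ℕ) : ℤ) - min (j : ℤ) x = j - min (j : ℤ) x + 1 := by omega
        rw [if_neg h, e1, e2, Nat.cast_succ, Pi.single_add, Pi.single_add]
        abel

theorem routing_fullTurn (hN : 0 < x + y) (hy : 0 < y) (k : Fin n)
    (τ : ParticleConfig (Fin (n + 2))) :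
    ((pathGraph n x y).routing (pathActive hN k) ^ (x + y)) (zeroRotor n hN, τ) =
      (zeroRotor n hN, τ + fullTurn x y k) := by
  obtain ⟨N, hN'⟩ := Nat.exists_eq_succ_of_ne_zero hN.ne'
  have hpow : ∀ f : Equiv.Perm (pathGraph n x y).Config, f ^ (x + y) = f * f ^ N := fun f =>
    (congrArg (f ^ ·) hN').trans (pow_succ' f N)
  rw [hpow, Equiv.Perm.mul_apply, routing_pow_zeroRotor hN k τ N (by omega),
    routing_pathActive hN k ⟨N, by omega⟩ _ (by simp)]
  refine Prod.ext ?_ ?_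
  · simp only [Function.update_idem]
    rw [show finRotate _ (⟨N, by omega⟩ : Fin (x + y)) = ⟨0, hN⟩ from
      Fin.ext (by rw [finRotate_val, if_pos hN'.symm]), ← zeroRotor_pathActive,
      Function.update_eq_self]
  · have e1 : min (N : ℤ) x = x := by omega
    have e2 : (y : ℤ) = N - x + 1 := by omega
    have e3 : (x + y : ℤ) = N + 1 := by omega
    simp only
    rw [if_neg (by omega), e1, fullTurn, e3, e2, Pi.single_add, Pi.single_add]
    abel

theorem equivalent_add_smul_fullTurn (hN : 0 < x + y) (hy : 0 < y) (k : Fin n) (s : ℤ)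
    (τ : ParticleConfig (Fin (n + 2))) :
    (pathGraph n x y).Equivalent (zeroRotor n hN, τ) (zeroRotor n hN, τ + s • fullTurn x y k) := by
  have hnat : ∀ (j : ℕ) (τ : ParticleConfig (Fin (n + 2))), (pathGraph n x y).Equivalent
      (zeroRotor n hN, τ) (zeroRotor n hN, τ + (j : ℤ) • fullTurn x y k) := by
    intro j
    induction j with
    | zero => intro τ; simpa using RotorGraph.Equivalent.refl _
    | succ j ih =>
      intro τ
      have h := RotorGraph.equivalent_zpow (pathActive hN k) ((x + y : ℕ) : ℤ) (zeroRotor n hN, τ)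
      rw [zpow_natCast, routing_fullTurn hN hy] at h
      have h' := h.trans (ih _)
      rwa [add_assoc, ← one_add_zsmul, add_comm 1, ← Nat.cast_succ] at h'
  obtain ⟨j, rfl | rfl⟩ := s.eq_nat_or_neg
  · exact hnat j τ
  · have h := hnat j (τ + (-(j : ℤ)) • fullTurn x y k)
    rw [neg_smul, neg_add_cancel_right] at h
    simpa using h.symm

theorem equivalent_add_sum_fullTurn (hN : 0 < x + y) (hy : 0 < y) (s : Fin n → ℤ)
    (τ : ParticleConfig (Fin (n + 2))) (S : Finset (Fin n)) :
    (pathGraph n x y).Equivalent (zeroRotor n hN, τ)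
      (zeroRotor n hN, τ + ∑ k ∈ S, s k • fullTurn x y k) := by
  induction S using Finset.induction_on with
  | empty => simpa using RotorGraph.Equivalent.refl _
  | insert k S hk ih =>
    rw [Finset.sum_insert hk, add_comm (s k • _), ← add_assoc]
    exact ih.trans (equivalent_add_smul_fullTurn hN hy k (s k) _)

theorem tailSum_injective {σ τ : ParticleConfig (Fin (n + 2))}
    (h : ∀ k ≤ n, tailSum σ k = tailSum τ k)
    (hdeg : deg σ = deg τ) : σ = τ := by
  have hstep : ∀ (σ : ParticleConfig (Fin (n + 2))) (v : Fin (n + 2)) (k : ℕ), v.val = k + 1 →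
      σ v = tailSum σ k - tailSum σ (k + 1) := by
    intro σ v k hv
    rw [tailSum, tailSum, ← Finset.sum_sub_distrib, Finset.sum_eq_single v]
    · simp [hv]
    · intro b _ hb
      have : b.val ≠ k + 1 := fun h => hb (Fin.ext (h.trans hv.symm))
      split_ifs <;> omega
    · simp
  have hzero : ∀ (σ : ParticleConfig (Fin (n + 2))), σ 0 = deg σ - tailSum σ 0 := by
    intro σ
    rw [tailSum, deg, ← Finset.sum_sub_distrib, Finset.sum_eq_single 0]
    · simp
    · intro b _ hb
      rw [if_pos (Nat.pos_of_ne_zero fun h => hb (Fin.ext h)), sub_self]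
    · simp
  funext v
  rcases Nat.eq_zero_or_pos v.val with hv | hv
  · obtain rfl : v = 0 := Fin.ext hv
    rw [hzero σ, hzero τ, hdeg, h 0 n.zero_le]
  · obtain ⟨k, hk⟩ := Nat.exists_eq_succ_of_ne_zero hv.ne'
    have hkn : k ≤ n := by omega
    rw [hstep σ v k hk, hstep τ v k hk, h k hkn]
    rcases hkn.lt_or_eq with hkn | rfl
    · rw [h (k + 1) hkn]
    · rw [tailSum_last, tailSum_last]

theorem tailSum_sum {ι : Type*} (S : Finset ι) (f : ι → ParticleConfig (Fin (n + 2))) (k : ℕ) :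
    tailSum (∑ i ∈ S, f i) k = ∑ i ∈ S, tailSum (f i) k := by
  classical
  induction S using Finset.induction_on with
  | empty => simp [tailSum]
  | insert i S hi ih => rw [Finset.sum_insert hi, Finset.sum_insert hi, tailSum_add, ih]

theorem tailSum_fullTurn (k : Fin n) (j : ℕ) :
    tailSum (fullTurn x y k) j =
      (if j = k + 1 then (x : ℤ) else 0) - if j = k.val then (y : ℤ) else 0 := by
  rw [fullTurn, tailSum_sub, tailSum_add, tailSum_single, tailSum_single, tailSum_single]
  simp only [Fin.val_succ, Fin.val_castSucc]
  split_ifs <;> omega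

theorem sum_fin_ite_eq (s : ℕ → ℤ) (a : ℤ) (j : ℕ) (hs : ∀ k, n ≤ k → s (k + 1) = 0) :
    ∑ k : Fin n, s (k + 1) * (if j = k.val then a else 0) = a * s (j + 1) := by
  by_cases hj : j < n
  · rw [Finset.sum_eq_single ⟨j, hj⟩]
    · simp [mul_comm]
    · intro b _ hb
      rw [if_neg fun h => hb (Fin.ext h.symm), mul_zero]
    · simp
  · rw [hs j (not_lt.1 hj), mul_zero]
    exact Finset.sum_eq_zero fun k _ => by rw [if_neg (by omega), mul_zero]

theorem tailSum_sum_fullTurn (s : ℕ → ℤ) (hs0 : s 0 = 0) (hs : ∀ k, n ≤ k → s (k + 1) = 0)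
    {j : ℕ} (hj : j ≤ n) :
    tailSum (∑ k : Fin n, s (k + 1) • fullTurn x y k) j = x * s j - y * s (j + 1) := by
  rw [tailSum_sum]
  simp only [tailSum_smul, tailSum_fullTurn, mul_sub, Finset.sum_sub_distrib]
  rw [sum_fin_ite_eq s y j hs]
  congr 1
  cases j with
  | zero =>
    rw [hs0, mul_zero]
    exact Finset.sum_eq_zero fun k _ => by rw [if_neg (by omega), mul_zero]
  | succ j =>
    rw [← sum_fin_ite_eq s x j hs]
    exact Finset.sum_congr rfl fun k _ => by simp

/-- The second half of the classification: after turning all rotors to position `0`, two particle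
configurations with equal invariants differ by full turns of the rotors. -/
theorem equivalent_of_invariants_eq (hx : 0 < x) (hy : 0 < y) (hxy : Nat.Coprime x y)
    {c c' : (pathGraph n x y).Config}
    (h : pathVal x y n (configCoeff c) = pathVal x y n (configCoeff c'))
    (hdeg : deg c.2 = deg c'.2) : (pathGraph n x y).Equivalent c c' := by
  have hN : 0 < x + y := by omega
  obtain ⟨τ, hτ⟩ := exists_equivalent_zeroRotor hN c
  obtain ⟨τ', hτ'⟩ := exists_equivalent_zeroRotor hN c'
  refine hτ.trans (RotorGraph.Equivalent.trans ?_ hτ'.symm)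
  obtain ⟨e1, e2⟩ := invariants_eq_of_equivalent hN hy hτ
  obtain ⟨e1', e2'⟩ := invariants_eq_of_equivalent hN hy hτ'
  obtain ⟨s, hs0, hsn, hs⟩ := exists_of_pathVal_eq_zero (x := x) (y := y) (n := n)
    (c := fun k => tailSum τ' k - tailSum τ k) (by exact_mod_cast hx.ne')
    (Nat.isCoprime_iff_coprime.2 hxy) (by
      have : pathVal x y n (configCoeff (zeroRotor n hN, τ))
          = pathVal x y n (configCoeff (zeroRotor n hN, τ')) := by rw [← e1, ← e1', h]
      rw [pathVal_configCoeff, pathVal_configCoeff] at this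
      rw [pathVal_sub]
      have h1 : particleVal n x y τ = pathVal x y n (tailSum τ) := rfl
      have h2 : particleVal n x y τ' = pathVal x y n (tailSum τ') := rfl
      rw [← h1, ← h2]
      simp only at this
      linarith)
  have hkey := equivalent_add_sum_fullTurn hN hy (fun k => s (k + 1)) τ Finset.univ
  convert hkey using 2
  let s' : ℕ → ℤ := fun k => if k ≤ n then s k else 0
  have hs' : ∀ k ≤ n + 1, s' k = s k := by
    intro k hk
    by_cases h : k ≤ n
    · simp [s', h]
    · rw [show k = n + 1 by omega, hsn]; simp [s']
  have hsum : ∑ k : Fin n, s (k + 1) • fullTurn x y k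
      = ∑ k : Fin n, s' (k + 1) • fullTurn x y k :=
    Finset.sum_congr rfl fun k _ => by rw [hs' _ (by omega)]
  have htail : ∀ k ≤ n, tailSum τ' k = tailSum (τ + ∑ k : Fin n, s (k + 1) • fullTurn x y k) k := by
    intro k hk
    rw [tailSum_add, hsum, tailSum_sum_fullTurn s' (by rw [hs' 0 (by omega), hs0])
      (fun k hk => by simp [s']; omega) hk, hs' k (by omega), hs' (k + 1) (by omega), ← hs k hk]
    ring
  refine tailSum_injective htail ?_
  have hd := (invariants_eq_of_equivalent hN hy hkey).2
  simp only at e2 e2' hd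
  rw [← hd, ← e2', ← e2, hdeg]

/-! ### The range of `g` -/

theorem rotorVal_mem_iff (hx : 0 < x) (hy : 0 < y) (hxy : Nat.Coprime x y) (c : ℕ → ℤ) :
    pathVal x y n c ∈ Set.range (rotorVal n x y) ↔
      0 ≤ carry x y c n ∧ carry x y (fun k => c k + -1) n < 0 := by
  have hN : 0 < x + y := by omega
  rw [← exists_rotorCoeff_iff (by exact_mod_cast hx) (by exact_mod_cast hy)
    (Nat.isCoprime_iff_coprime.2 hxy)]
  constructor
  · rintro ⟨ρ, h⟩
    exact ⟨fun k => position ρ k, position_mem hN ρ, position_of_sink ρ (Or.inl rfl),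
      position_of_sink ρ (Or.inr n.lt_succ_self), h⟩
  · rintro ⟨i, hi, hi0, hin, h⟩
    have hlt : ∀ k, (i k).toNat < x + y := fun k => by have := hi k; omega
    let ρ : (pathGraph n x y).RotorConfig := fun u =>
      ⟨(u.2.choose.1, ⟨(i u.1.val).toNat, hlt _⟩), u.2.choose_spec⟩
    refine ⟨ρ, ?_⟩
    rw [← h, rotorVal]
    have hpos : ∀ k ≤ n + 1, position ρ (k : ℕ) = i k := by
      intro k hk
      by_cases hks : k = 0 ∨ n < k
      · rw [position_of_sink _ hks]
        rcases hks with rfl | hks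
        · exact hi0.symm
        · rw [show k = n + 1 by omega, hin]
      · obtain ⟨k, rfl⟩ := Nat.exists_eq_succ_of_ne_zero (not_or.1 hks).1
        have h1 := position_succ hN ρ ⟨k, by omega⟩
        simp only at h1
        rw [Nat.succ_eq_add_one, h1]
        exact Int.toNat_of_nonneg (hi (k + 1)).1
    exact pathVal_congr fun k hk => by
      simp only [rotorCoeff]
      rw [hpos k (by omega), hpos (k + 1) (by omega)]

theorem rotorVal_mem_configCoeff_iff (hx : 0 < x) (hy : 0 < y) (hxy : Nat.Coprime x y)
    (c : (pathGraph n x y).Config) (m : ℤ) :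
    rotorVal n x y c.1 - particleVal n x y c.2 + m * pathF n x y ∈ Set.range (rotorVal n x y) ↔
      0 ≤ carry x y (fun k => configCoeff c k + m) n ∧
        carry x y (fun k => configCoeff c k + (m - 1)) n < 0 := by
  rw [← pathVal_configCoeff_add, rotorVal_mem_iff hx hy hxy]
  simp only [add_assoc, sub_eq_add_neg]

theorem rotorVal_nonneg_lt (hx : 0 < x) (hy : 0 < y) (hxy : Nat.Coprime x y) {v : ℤ}
    (hv : v ∈ Set.range (rotorVal n x y)) : 0 ≤ v ∧ v < x * pathF n x y := by
  obtain ⟨ρ, rfl⟩ := hv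
  have h : rotorVal n x y ρ ∈ Set.range (rotorVal n x y) := ⟨ρ, rfl⟩
  rw [rotorVal, rotorVal_mem_iff hx hy hxy] at h
  rw [← pathVal_one]
  exact ⟨pathVal_nonneg_of_carry (by positivity) (by exact_mod_cast hy) h.1,
    pathVal_lt_of_carry (by exact_mod_cast hx) (by exact_mod_cast hy) h.2⟩

theorem existsUnique_rotorVal_mem (hx : 0 < x) (hy : 0 < y) (hxy : Nat.Coprime x y)
    (c : (pathGraph n x y).Config) :
    ∃! m : ℤ, rotorVal n x y c.1 - particleVal n x y c.2 + m * pathF n x y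
      ∈ Set.range (rotorVal n x y) := by
  simp only [rotorVal_mem_configCoeff_iff hx hy hxy]
  have hx' : (0 : ℤ) ≤ x := by positivity
  have hy' : (0 : ℤ) < y := by exact_mod_cast hy
  obtain ⟨m, hm⟩ := exists_carry_sign_change hx' hy' (configCoeff c) n
  exact ⟨m, hm, fun m' hm' => sign_change_unique (carry_strictMono hx' hy' _ n) hm' hm⟩

/-- As `g` takes values in `[0, x * F)`, the solution `m` is confined to an interval of length `x`. -/
theorem neg_ediv_le_and_le (hx : 0 < x) (hy : 0 < y) (hxy : Nat.Coprime x y) {v m : ℤ}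
    (hm : v + m * pathF n x y ∈ Set.range (rotorVal n x y)) :
    -(v / pathF n x y) ≤ m ∧ m ≤ -(v / pathF n x y) + (x - 1) := by
  obtain ⟨h1, h2⟩ := rotorVal_nonneg_lt hx hy hxy hm
  have hF : (0 : ℤ) < pathF n x y := by
    rw [← pathVal_one]; exact pathVal_one_pos (by exact_mod_cast hx) (by exact_mod_cast hy)
  generalize (pathF n x y : ℤ) = F at *
  have e1 := Int.mul_ediv_self_le (x := v) (k := F) hF.ne'
  have e2 := Int.lt_mul_ediv_self_add (x := v) (k := F) hF
  generalize v / F = q at *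
  constructor
  · have : (-(m + q) - 1) * F < 0 := by linarith
    have := neg_of_mul_neg_left this hF.le
    omega
  · have : (m + q - x) * F < 0 := by linarith
    have := neg_of_mul_neg_left this hF.le
    omega

theorem ceil_eq_neg_ediv {v F : ℤ} (hF : 0 < F) : ⌈((-v : ℤ) : ℚ) / (F : ℚ)⌉ = -(v / F) := by
  rw [Int.ceil_eq_iff]
  have e1 := Int.mul_ediv_self_le (x := v) (k := F) hF.ne'
  have e2 := Int.lt_mul_ediv_self_add (x := v) (k := F) hF
  have hF' : (0 : ℚ) < F := by exact_mod_cast hF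
  constructor
  · rw [lt_div_iff₀ hF']
    have : (-(v / F) - 1) * F < -v := by linarith
    exact_mod_cast this
  · rw [div_le_iff₀ hF']
    have : -v ≤ -(v / F) * F := by linarith
    exact_mod_cast this

/-- A full routing ends with `m` particles on `u_{n+1}` for the `m` found from the invariant:
such a configuration has the right invariants, and no other sink values do. -/
theorem routingInf_spec (hx : 0 < x) (hy : 0 < y) (hxy : Nat.Coprime x y)
    (c : (pathGraph n x y).Config) :
    ((pathGraph n x y).routingInf c).Nonempty ∧
      ∀ c' ∈ (pathGraph n x y).routingInf c, ∀ m : ℤ, c'.2 (Fin.last (n + 1)) = m ↔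
        rotorVal n x y c.1 - particleVal n x y c.2 + m * pathF n x y
          ∈ Set.range (rotorVal n x y) := by
  have hN : 0 < x + y := by omega
  obtain ⟨m, hm, huniq⟩ := existsUnique_rotorVal_mem hx hy hxy c
  simp only at hm huniq
  constructor
  -- Put `m` particles on `u_{n+1}` and, for the degree to agree, the others on `u_0`.
  · obtain ⟨ρ, hρ⟩ := hm
    set τ : ParticleConfig (Fin (n + 2)) :=
      Pi.single (Fin.last (n + 1)) m + Pi.single 0 (deg c.2 - m) with hτ
    have hval : particleVal n x y τ = m * pathF n x y := by
      rw [← pathVal_one, ← pathVal_const]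
      refine pathVal_congr fun k hk => ?_
      rw [hτ, tailSum_add, tailSum_single, tailSum_single]
      simp [Nat.lt_succ_of_le hk]
    refine ⟨(ρ, τ), equivalent_of_invariants_eq hx hy hxy ?_ ?_, fun u => ?_⟩
    · rw [pathVal_configCoeff, pathVal_configCoeff, hρ, hval]; ring
    · rw [hτ, deg_add, deg_single, deg_single]; ring
    · obtain ⟨k, rfl⟩ := exists_eq_pathActive hN u
      simp only [hτ, pathActive, Pi.add_apply]
      rw [Pi.single_eq_of_ne, Pi.single_eq_of_ne, add_zero]
      · exact fun h => by simpa using congrArg Fin.val h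
      · intro h
        have := congrArg Fin.val h
        simp at this
        omega
  · rintro c' ⟨heq, hzero⟩ m'
    have hinv := (invariants_eq_of_equivalent hN hy heq).1
    have hval : particleVal n x y c'.2 = c'.2 (Fin.last (n + 1)) * pathF n x y := by
      rw [← pathVal_one, ← pathVal_const]
      refine pathVal_congr fun k hk => ?_
      rw [tailSum, Finset.sum_eq_single (Fin.last (n + 1))]
      · simp [Nat.lt_succ_of_le hk]
      · intro u _ hu
        split_ifs with hku
        · have hu' : u.val ≠ n + 1 := fun h => hu (Fin.ext h)
          have := hzero (pathActive hN ⟨u.val - 1, by omega⟩)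
          rw [show (pathActive hN ⟨u.val - 1, by omega⟩ : (pathGraph n x y).Active).1 = u from
            Fin.ext (by simp [pathActive]; omega)] at this
          exact this
        · rfl
      · simp
    rw [pathVal_configCoeff, pathVal_configCoeff, hval] at hinv
    have hlast : rotorVal n x y c.1 - particleVal n x y c.2
        + c'.2 (Fin.last (n + 1)) * pathF n x y ∈ Set.range (rotorVal n x y) :=
      ⟨c'.1, by rw [hinv]; ring⟩
    constructor
    · rintro rfl; exact hlast
    · exact fun h => (huniq _ hlast).trans (huniq _ h).symm

end Path

/-! ### Total correctness with time bounds -/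

/-- Started in `s`, the program `p` halts within `T` operations in a memory that satisfies `P`. -/
def Program.Runs (p : Program) (s : Memory) (P : Memory → Prop) (T : ℕ) : Prop :=
  ∃ s' t, Exec p s s' t ∧ P s' ∧ t ≤ T

namespace Program.Runs

variable {p q : Program} {s : Memory} {P Q : Memory → Prop} {T T' : ℕ} {e₁ e₂ : Expr}

theorem mono (h : p.Runs s P T) (hP : ∀ s', P s' → Q s') (hT : T ≤ T') : p.Runs s Q T' := by
  obtain ⟨s', t, h1, h2, h3⟩ := h
  exact ⟨s', t, h1, hP _ h2, h3.trans hT⟩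

theorem le (h : p.Runs s P T) (hT : T ≤ T') : p.Runs s P T' := h.mono (fun _ => id) hT

theorem skip (h : P s) : Program.skip.Runs s P 1 := ⟨s, 1, .skip s, h, le_rfl⟩

theorem set {i : ℕ} {e : Expr} (h : P ⟨Function.update s.reg i (e.eval s), s.arr⟩) :
    (Program.set i e).Runs s P (e.cost + 1) := ⟨_, _, .set s i e, h, le_rfl⟩

theorem put {a : ℕ} (h : P ⟨s.reg, Function.update s.arr a
      (Function.update (s.arr a) (e₁.eval s) (e₂.eval s))⟩) :
    (Program.put a e₁ e₂).Runs s P (e₁.cost + e₂.cost + 1) := ⟨_, _, .put s a e₁ e₂, h, le_rfl⟩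

theorem seq (h : p.Runs s Q T) (h' : ∀ s', Q s' → q.Runs s' P T') :
    (Program.seq p q).Runs s P (T + T') := by
  obtain ⟨s', t, h1, h2, h3⟩ := h
  obtain ⟨s'', t', h4, h5, h6⟩ := h' s' h2
  exact ⟨s'', _, .seq h1 h4, h5, add_le_add h3 h6⟩

theorem set_seq {i : ℕ} {e : Expr}
    (h : q.Runs ⟨Function.update s.reg i (e.eval s), s.arr⟩ P T) :
    (Program.seq (.set i e) q).Runs s P (e.cost + 1 + T) :=
  seq (Q := fun s' => s' = ⟨Function.update s.reg i (e.eval s), s.arr⟩) (set rfl)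
    fun _ h' => h' ▸ h

theorem put_seq {a : ℕ} (h : q.Runs ⟨s.reg, Function.update s.arr a
      (Function.update (s.arr a) (e₁.eval s) (e₂.eval s))⟩ P T) :
    (Program.seq (.put a e₁ e₂) q).Runs s P (e₁.cost + e₂.cost + 1 + T) :=
  seq (Q := fun s' => s' = ⟨s.reg, Function.update s.arr a
      (Function.update (s.arr a) (e₁.eval s) (e₂.eval s))⟩) (put rfl) fun _ h' => h' ▸ h

theorem ifLe (h : e₁.eval s ≤ e₂.eval s → p.Runs s P T)
    (h' : ¬ e₁.eval s ≤ e₂.eval s → q.Runs s P T) :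
    (Program.ifLe e₁ e₂ p q).Runs s P (e₁.cost + e₂.cost + 1 + T) := by
  by_cases hc : e₁.eval s ≤ e₂.eval s
  · obtain ⟨s', t, h1, h2, h3⟩ := h hc
    exact ⟨s', _, .ifTrue hc h1, h2, by omega⟩
  · obtain ⟨s', t, h1, h2, h3⟩ := h' hc
    exact ⟨s', _, .ifFalse hc h1, h2, by omega⟩

/-- The rule for loops: `I k` is an invariant that leaves at most `k` further iterations, each of
which executes the body within `B` operations. -/
theorem whileLe (I : ℕ → Memory → Prop) (B : ℕ)
    (hbody : ∀ k s, I k s → e₁.eval s ≤ e₂.eval s → ∃ k', k = k' + 1 ∧ p.Runs s (I k') B)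
    {k : ℕ} (h : I k s) :
    (Program.whileLe e₁ e₂ p).Runs s (fun s' => (∃ k', I k' s') ∧ ¬ e₁.eval s' ≤ e₂.eval s')
      (k * (e₁.cost + e₂.cost + 1 + B) + (e₁.cost + e₂.cost + 1)) := by
  induction k using Nat.strong_induction_on generalizing s with
  | _ k ih =>
    by_cases hc : e₁.eval s ≤ e₂.eval s
    · obtain ⟨k', rfl, s', t, h1, h2, h3⟩ := hbody k s h hc
      obtain ⟨s'', t', h4, h5, h6⟩ := ih k' k'.lt_succ_self h2
      exact ⟨s'', _, .whileTrue hc h1 h4, h5, by rw [add_mul, one_mul]; omega⟩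
    · exact ⟨s, _, .whileFalse hc, ⟨⟨k, h⟩, hc⟩, by omega⟩

end Program.Runs

/-- The program that replaces register `i` by its minimum with register `2`. -/
def Program.capReg (i : ℕ) : Program := .ifLe (.reg 2) (.reg i) (.set i (.reg 2)) .skip

theorem Program.Runs.capReg_seq {q : Program} {s : Memory} {P : Memory → Prop} {T i : ℕ}
    (h : q.Runs ⟨Function.update s.reg i (rightMoves (s.reg 2) (s.reg i)), s.arr⟩ P T) :
    (Program.seq (.capReg i) q).Runs s P (5 + T) := by
  refine .seq (T := 5)
    (Q := fun s' => s' = ⟨Function.update s.reg i (rightMoves (s.reg 2) (s.reg i)), s.arr⟩)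
    (.le (.ifLe (T := 2) (fun hc => .set ?_) fun hc => .le (.skip ?_) one_le_two) le_rfl)
    fun _ h' => h' ▸ h
  · simp only [Expr.eval] at hc ⊢
    rw [rightMoves, min_eq_right hc]
  · simp only [Expr.eval, not_le] at hc
    rw [rightMoves, min_eq_left hc.le, Function.update_eq_self]

/-! ### Programs -/

/-- Registers `1, 2, 3, 4` hold `n, x, y, m` and cells `0, …, n` of array `2` hold `c`. -/
structure HoldsCoeffs (n x y : ℕ) (m : ℤ) (c : ℕ → ℤ) (s : Memory) : Prop where
  reg_one : s.reg 1 = n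
  reg_two : s.reg 2 = x
  reg_three : s.reg 3 = y
  reg_four : s.reg 4 = m
  arr_two : ∀ k ≤ n, s.arr 2 k = c k

variable {n x y : ℕ} {m : ℤ} {c : ℕ → ℤ} {s : Memory}

/-- Carry propagation, into register `6`, from the coefficients in array `2` increased by
register `4`. -/
def carryProgram : Program :=
  .seq (.set 6 (.add (.get 2 (.lit 0)) (.reg 4))) <|
  .seq (.set 5 (.lit 1)) <|
  .whileLe (.reg 5) (.reg 1) <|
    .seq (.set 6 (.add (.add (.get 2 (.reg 5)) (.reg 4))
      (.mul (.reg 2) (.div (.reg 6) (.reg 3))))) <|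
    .set 5 (.add (.reg 5) (.lit 1))

theorem carryProgram_runs (h : HoldsCoeffs n x y m c s) :
    carryProgram.Runs s (fun s' => HoldsCoeffs n x y m c s' ∧
      s'.reg 6 = carry x y (fun k => c k + m) n ∧ ∀ i, 7 ≤ i → s'.reg i = s.reg i)
      (20 * n + 20) := by
  let I : ℕ → Memory → Prop := fun j s' => ∃ k : ℕ, k + j = n ∧ HoldsCoeffs n x y m c s' ∧
    s'.reg 5 = k + 1 ∧ s'.reg 6 = carry x y (fun k => c k + m) k ∧ ∀ i, 7 ≤ i → s'.reg i = s.reg i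
  refine .mono (.set_seq (.set_seq (.whileLe I 16 ?_ (k := n) ?_))) ?_ ?_
  · rintro j s' ⟨k, hk, hs, h5, h6, hfr⟩ hc
    simp only [Expr.eval, h5, hs.reg_one] at hc
    obtain ⟨j, rfl⟩ := Nat.exists_eq_succ_of_ne_zero (show j ≠ 0 by omega)
    have harr := hs.arr_two (k + 1) (by omega)
    push_cast at harr
    refine ⟨j, rfl, .le (.set_seq (.set ?_)) (by decide)⟩
    refine ⟨k + 1, by omega, ⟨?_, ?_, ?_, ?_, hs.arr_two⟩, ?_, ?_, fun i hi => ?_⟩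
    · simpa [Function.update_apply] using hs.reg_one
    · simpa [Function.update_apply] using hs.reg_two
    · simpa [Function.update_apply] using hs.reg_three
    · simpa [Function.update_apply] using hs.reg_four
    · simp [Expr.eval, h5]
    · simp [Expr.eval, h5, h6, carry, harr, hs.reg_two, hs.reg_three,
        hs.reg_four]
    · rw [← hfr i hi]
      simp [show i ≠ 5 by omega, show i ≠ 6 by omega]
  · have harr := h.arr_two 0 n.zero_le
    refine ⟨0, by omega, ⟨?_, ?_, ?_, ?_, h.arr_two⟩, ?_, ?_, fun i hi => ?_⟩
    · simpa [Function.update_apply] using h.reg_one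
    · simpa [Function.update_apply] using h.reg_two
    · simpa [Function.update_apply] using h.reg_three
    · simpa [Function.update_apply] using h.reg_four
    · simp [Expr.eval]
    · simpa [Function.update_apply, Expr.eval, carry, h.reg_four] using harr
    · simp [show i ≠ 5 by omega, show i ≠ 6 by omega]
  · rintro s' ⟨⟨j, k, hk, hs, h5, h6, hfr⟩, hc⟩
    simp only [Expr.eval, h5, hs.reg_one] at hc
    obtain rfl : k = n := by omega
    exact ⟨hs, h6, hfr⟩
  · simp only [Expr.cost]
    omega

/-- Decides from the coefficients in array `2` whether carry propagation ends nonnegative with the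
offset in register `4` and negative with the offset decreased by `1`. -/
def signTestProgram : Program :=
  .seq carryProgram <|
  .seq (.set 7 (.reg 6)) <|
  .seq (.set 4 (.sub (.reg 4) (.lit 1))) <|
  .seq carryProgram <|
  .seq (.set 0 (.lit 0)) <|
  .ifLe (.lit 0) (.reg 7) (.ifLe (.lit 0) (.reg 6) .skip (.set 0 (.lit 1))) .skip

theorem signTestProgram_runs (h : HoldsCoeffs n x y m c s) :
    signTestProgram.Runs s (fun s' => s'.reg 0 =
      if 0 ≤ carry x y (fun k => c k + m) n ∧ carry x y (fun k => c k + (m - 1)) n < 0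
        then 1 else 0) (40 * n + 60) := by
  refine .le (.seq (carryProgram_runs h) (T' := 20 * n + 40) ?_) (by omega)
  rintro s₁ ⟨h1, h6, -⟩
  have h1' : HoldsCoeffs n x y (m - 1) c ⟨Function.update (Function.update s₁.reg 7
      (s₁.reg 6)) 4 (m - 1), s₁.arr⟩ := by
    refine ⟨?_, ?_, ?_, ?_, h1.arr_two⟩
    · simpa [Function.update_apply] using h1.reg_one
    · simpa [Function.update_apply] using h1.reg_two
    · simpa [Function.update_apply] using h1.reg_three
    · simp
  refine .le (.set_seq (.set_seq (.seq (Q := fun s₂ => s₂.reg 7 = s₁.reg 6 ∧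
    s₂.reg 6 = carry x y (fun k => c k + (m - 1)) n) (T := 20 * n + 20) (T' := 12) ?_ ?_))) ?_
  · have e : (Expr.sub (.reg 4) (.lit 1)).eval
        ⟨Function.update s₁.reg 7 ((Expr.reg 6).eval s₁), s₁.arr⟩ = m - 1 := by
      simp [Expr.eval, h1.reg_four]
    rw [e]
    refine (carryProgram_runs h1').mono ?_ le_rfl
    rintro s₂ ⟨-, h6', hfr⟩
    refine ⟨?_, h6'⟩
    rw [hfr 7 le_rfl]
    simp
  · rintro s₂ ⟨h7, h6'⟩
    refine .le (.set_seq (.ifLe (T := 5) (fun hc => .ifLe (T := 2) (fun hc' => .le (.skip ?_)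
      one_le_two) fun hc' => .set ?_) fun hc => .le (.skip ?_) (by norm_num)))
      (by decide)
    all_goals simp [Expr.eval, h7, h6, h6'] at *
    · exact fun _ => hc'
    · exact ⟨hc, hc'⟩
    · exact fun h => absurd h (not_le.2 hc)
  · simp only [Expr.cost]
    omega

/-- Writes the coefficients of `g ρ - h σ` into array `2`, from `u_n` downwards. -/
def configCoeffProgram : Program :=
  .seq (.set 5 (.reg 1)) <|
  .seq (.set 6 (.lit 0)) <|
  .whileLe (.lit 0) (.reg 5) <|
    .seq (.set 6 (.add (.reg 6) (.get 1 (.add (.reg 5) (.lit 1))))) <|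
    .seq (.set 7 (.get 0 (.reg 5))) <|
    .seq (.capReg 7) <|
    .seq (.set 8 (.get 0 (.add (.reg 5) (.lit 1)))) <|
    .seq (.set 9 (.reg 8)) <|
    .seq (.capReg 9) <|
    .seq (.put 2 (.reg 5) (.sub (.sub (.reg 7) (.sub (.reg 8) (.reg 9))) (.reg 6))) <|
    .set 5 (.sub (.reg 5) (.lit 1))

theorem tailSum_eq_add (σ : ParticleConfig (Fin (n + 2))) (k : ℕ) :
    tailSum σ k = tailSum σ (k + 1)
      + ∑ u : Fin (n + 2), if (u.val : ℤ) = (k : ℤ) + 1 then σ u else 0 := by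
  rw [tailSum, tailSum, ← Finset.sum_add_distrib]
  refine Finset.sum_congr rfl fun u _ => ?_
  split_ifs <;> omega

theorem configCoeffProgram_runs (c : (pathGraph n x y).Config) (m : ℤ) :
    configCoeffProgram.Runs (inputConfig c m) (HoldsCoeffs n x y m (configCoeff c))
      (60 * n + 80) := by
  -- Before the iteration for `u_k`, at most `j = k + 1` iterations are left.
  let I : ℕ → Memory → Prop := fun j s => j ≤ n + 1 ∧ s.reg 1 = n ∧ s.reg 2 = x ∧ s.reg 3 = y ∧
    s.reg 4 = m ∧ s.arr 0 = (fun k => position c.1 k) ∧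
    s.arr 1 = (fun k => ∑ u : Fin (n + 2), if (u.val : ℤ) = k then c.2 u else 0) ∧
    s.reg 5 = j - 1 ∧ s.reg 6 = tailSum c.2 j ∧ ∀ k ≤ n, j ≤ k → s.arr 2 k = configCoeff c k
  refine .mono (.set_seq (.set_seq (.whileLe I 50 ?_ (k := n + 1) ?_))) ?_ ?_
  · rintro j s ⟨hj, h1, h2, h3, h4, ha0, ha1, h5, h6, ha2⟩ hc
    simp only [Expr.eval, h5] at hc
    obtain ⟨j, rfl⟩ := Nat.exists_eq_succ_of_ne_zero (show j ≠ 0 by omega)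
    refine ⟨j, rfl, .le (.set_seq (.set_seq (.capReg_seq (.set_seq (.set_seq (.capReg_seq
      (.put_seq (.set ?_)))))))) (by decide)⟩
    have h5' : s.reg 5 = j := by rw [h5]; push_cast; ring
    refine ⟨by omega, ?_, ?_, ?_, ?_, ?_, ?_, ?_, ?_, fun k hk hjk => ?_⟩
    · simpa [Function.update_apply] using h1
    · simpa [Function.update_apply] using h2
    · simpa [Function.update_apply] using h3
    · simpa [Function.update_apply] using h4
    · simpa [Function.update_apply] using ha0
    · simpa [Function.update_apply] using ha1
    · simp [Expr.eval, h5']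
    · simp [Expr.eval, h5', h6, ha1, tailSum_eq_add c.2 j]
    · rcases hjk.eq_or_lt with rfl | hjk
      · simp [Expr.eval, h5', h6, ha1, ha0, h2, configCoeff, rotorCoeff,
          tailSum_eq_add c.2 j]
      · have : ¬ ((k : ℤ) = j) := by omega
        simpa [Function.update_apply, Expr.eval, h5', this] using ha2 k hk hjk
  · refine ⟨le_rfl, rfl, rfl, rfl, rfl, rfl, rfl, ?_, ?_, fun k hk hk' => by omega⟩
    · simp [Expr.eval, inputConfig, inputRegs]
    · simp [Expr.eval, tailSum_last]
  · rintro s ⟨⟨j, hj, h1, h2, h3, h4, ha0, ha1, h5, h6, ha2⟩, hc⟩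
    simp only [Expr.eval, h5] at hc
    exact ⟨h1, h2, h3, h4, fun k hk => ha2 k hk (by omega)⟩
  · simp only [Expr.cost]
    omega

theorem Program.Runs.decides {p : Program} {φ : Prop} [Decidable φ] {T : ℕ}
    (h : p.Runs s (fun s' => s'.reg 0 = if φ then 1 else 0) T) : p.Decides s φ T := by
  obtain ⟨s', t, h1, h2, h3⟩ := h
  exact ⟨fun hφ => ⟨s', t, h1, by rw [h2, if_pos hφ], h3⟩,
    fun hφ => ⟨s', t, h1, by rw [h2, if_neg hφ], h3⟩⟩

theorem Program.Decides.le {p : Program} {φ : Prop} {T T' : ℕ} (h : p.Decides s φ T)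
    (hT : T ≤ T') : p.Decides s φ T' := by
  refine ⟨fun hφ => ?_, fun hφ => ?_⟩
  · obtain ⟨s', t, h1, h2, h3⟩ := h.1 hφ
    exact ⟨s', t, h1, h2, h3.trans hT⟩
  · obtain ⟨s', t, h1, h2, h3⟩ := h.2 hφ
    exact ⟨s', t, h1, h2, h3.trans hT⟩

theorem testConfigProgram_decides (c : (pathGraph n x y).Config) (m : ℤ) :
    (Program.seq configCoeffProgram signTestProgram).Decides (inputConfig c m)
      (0 ≤ carry x y (fun k => configCoeff c k + m) n ∧
        carry x y (fun k => configCoeff c k + (m - 1)) n < 0) (100 * n + 140) :=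
  Program.Runs.decides <| .le (.seq (configCoeffProgram_runs c m) fun _ h => signTestProgram_runs h)
    (by omega)

/-- Evaluates `pathVal` of the coefficients in array `2` into register `8` and `F` into
register `9`. -/
def pathValProgram : Program :=
  .seq (.set 8 (.get 2 (.lit 0))) <|
  .seq (.set 9 (.lit 1)) <|
  .seq (.set 10 (.lit 1)) <|
  .seq (.set 5 (.lit 1)) <|
  .whileLe (.reg 5) (.reg 1) <|
    .seq (.set 10 (.mul (.reg 10) (.reg 3))) <|
    .seq (.set 8 (.add (.mul (.reg 2) (.reg 8)) (.mul (.get 2 (.reg 5)) (.reg 10)))) <|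
    .seq (.set 9 (.add (.mul (.reg 2) (.reg 9)) (.reg 10))) <|
    .set 5 (.add (.reg 5) (.lit 1))

theorem pathValProgram_runs (h : HoldsCoeffs n x y m c s) :
    pathValProgram.Runs s (fun s' => HoldsCoeffs n x y m c s' ∧
      s'.reg 8 = pathVal x y n c ∧ s'.reg 9 = pathVal x y n (fun _ => 1)) (40 * n + 40) := by
  let I : ℕ → Memory → Prop := fun j s' => ∃ k : ℕ, k + j = n ∧ HoldsCoeffs n x y m c s' ∧
    s'.reg 5 = k + 1 ∧ s'.reg 8 = pathVal x y k c ∧ s'.reg 9 = pathVal x y k (fun _ => 1) ∧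
    s'.reg 10 = (y : ℤ) ^ k
  refine .mono (.set_seq (.set_seq (.set_seq (.set_seq (.whileLe I 37 ?_ (k := n) ?_))))) ?_ ?_
  · rintro j s' ⟨k, hk, hs, h5, h8, h9, h10⟩ hc
    simp only [Expr.eval, h5, hs.reg_one] at hc
    obtain ⟨j, rfl⟩ := Nat.exists_eq_succ_of_ne_zero (show j ≠ 0 by omega)
    have harr := hs.arr_two (k + 1) (by omega)
    push_cast at harr
    refine ⟨j, rfl, .le (.set_seq (.set_seq (.set_seq (.set ?_)))) (by decide)⟩
    refine ⟨k + 1, by omega, ⟨?_, ?_, ?_, ?_, hs.arr_two⟩, ?_, ?_, ?_, ?_⟩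
    · simpa [Function.update_apply] using hs.reg_one
    · simpa [Function.update_apply] using hs.reg_two
    · simpa [Function.update_apply] using hs.reg_three
    · simpa [Function.update_apply] using hs.reg_four
    · simp [Expr.eval, h5]
    · simp [Expr.eval, h5, h8, h10, harr, hs.reg_two, hs.reg_three, pathVal_succ, pow_succ]
    · simp [Expr.eval, h9, h10, hs.reg_two, hs.reg_three, pathVal_succ, pow_succ]
    · simp [Expr.eval, h10, hs.reg_three, pow_succ]
  · have harr := h.arr_two 0 n.zero_le
    refine ⟨0, by omega, ⟨?_, ?_, ?_, ?_, h.arr_two⟩, ?_, ?_, ?_, ?_⟩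
    · simpa [Function.update_apply] using h.reg_one
    · simpa [Function.update_apply] using h.reg_two
    · simpa [Function.update_apply] using h.reg_three
    · simpa [Function.update_apply] using h.reg_four
    · simp [Expr.eval]
    · simpa [Function.update_apply, Expr.eval, pathVal_zero] using harr
    · simp [Expr.eval, pathVal_zero]
    · simp [Expr.eval]
  · rintro s' ⟨⟨j, k, hk, hs, h5, h8, h9, -⟩, hc⟩
    simp only [Expr.eval, h5, hs.reg_one] at hc
    obtain rfl : k = n := by omega
    exact ⟨hs, h8, h9⟩
  · simp only [Expr.cost]
    omega

/-- Binary search for the sign change of carry propagation as a function of the offset, starting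
from the bounds in registers `7` and `8`. -/
def searchProgram : Program :=
  .seq (.whileLe (.add (.reg 7) (.lit 2)) (.reg 8) <|
    .seq (.set 4 (.div (.add (.reg 7) (.reg 8)) (.lit 2))) <|
    .seq carryProgram <|
    .ifLe (.lit 0) (.reg 6) (.set 8 (.reg 4)) (.set 7 (.reg 4))) <|
  .set 0 (.reg 8)

theorem searchProgram_runs (h : HoldsCoeffs n x y m c s) {L : ℕ} (hlt : s.reg 7 < s.reg 8)
    (hL : s.reg 8 - s.reg 7 ≤ 2 ^ L)
    (h7 : carry x y (fun k => c k + s.reg 7) n < 0)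
    (h8 : 0 ≤ carry x y (fun k => c k + s.reg 8) n) :
    searchProgram.Runs s (fun s' => 0 ≤ carry x y (fun k => c k + s'.reg 0) n ∧
      carry x y (fun k => c k + (s'.reg 0 - 1)) n < 0) (L * (20 * n + 40) + 10) := by
  let I : ℕ → Memory → Prop := fun j s' => (∃ m, HoldsCoeffs n x y m c s') ∧
    s'.reg 7 < s'.reg 8 ∧ s'.reg 8 - s'.reg 7 ≤ 2 ^ j ∧
    carry x y (fun k => c k + s'.reg 7) n < 0 ∧ 0 ≤ carry x y (fun k => c k + s'.reg 8) n
  refine .mono (.seq (.whileLe I (20 * n + 33) ?_ (k := L) ⟨⟨m, h⟩, hlt, hL, h7, h8⟩)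
    (P := fun s' => 0 ≤ carry x y (fun k => c k + s'.reg 0) n ∧
      carry x y (fun k => c k + (s'.reg 0 - 1)) n < 0) (T' := 2) ?_) (fun _ => id) ?_
  · rintro j s' ⟨⟨m', hs⟩, hlt, hj, h7, h8⟩ hc
    simp only [Expr.eval] at hc
    obtain ⟨j, rfl⟩ : ∃ i, j = i + 1 := by
      refine Nat.exists_eq_succ_of_ne_zero ?_
      rintro rfl
      norm_num at hj
      omega
    rw [pow_succ] at hj
    set mid := (s'.reg 7 + s'.reg 8) / 2 with hmid
    have hs' : HoldsCoeffs n x y mid c ⟨Function.update s'.reg 4 mid, s'.arr⟩ := by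
      refine ⟨?_, ?_, ?_, ?_, hs.arr_two⟩
      · simpa [Function.update_apply] using hs.reg_one
      · simpa [Function.update_apply] using hs.reg_two
      · simpa [Function.update_apply] using hs.reg_three
      · simp
    refine ⟨j, rfl, .le (.set_seq (.seq (carryProgram_runs hs') (T' := 5) ?_))
      (by simp only [Expr.cost]; omega)⟩
    rintro s₂ ⟨hs₂, h6, hfr⟩
    have e7 : s₂.reg 7 = s'.reg 7 := by rw [hfr 7 le_rfl]; simp
    have e8 : s₂.reg 8 = s'.reg 8 := by rw [hfr 8 (by norm_num)]; simp
    refine .le (.ifLe (T := 2) (fun hc' => .set ?_) fun hc' => .set ?_) le_rfl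
    · simp only [Expr.eval, h6] at hc'
      refine ⟨⟨mid, ⟨?_, ?_, ?_, ?_, hs₂.arr_two⟩⟩, ?_⟩
      · simpa [Function.update_apply] using hs₂.reg_one
      · simpa [Function.update_apply] using hs₂.reg_two
      · simpa [Function.update_apply] using hs₂.reg_three
      · simpa [Function.update_apply] using hs₂.reg_four
      · simp only [Expr.eval, Function.update_self, hs₂.reg_four,
          Function.update_of_ne (show (7 : ℕ) ≠ 8 by norm_num), e7]
        exact ⟨by omega, by omega, h7, hc'⟩
    · simp only [Expr.eval, h6] at hc'
      refine ⟨⟨mid, ⟨?_, ?_, ?_, ?_, hs₂.arr_two⟩⟩, ?_⟩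
      · simpa [Function.update_apply] using hs₂.reg_one
      · simpa [Function.update_apply] using hs₂.reg_two
      · simpa [Function.update_apply] using hs₂.reg_three
      · simpa [Function.update_apply] using hs₂.reg_four
      · simp only [Expr.eval, Function.update_self, hs₂.reg_four,
          Function.update_of_ne (show (8 : ℕ) ≠ 7 by norm_num), e8]
        exact ⟨by omega, by omega, not_le.1 hc', h8⟩
  · rintro s' ⟨⟨j, -, hlt, -, h7, h8⟩, hc⟩
    simp only [Expr.eval] at hc
    refine .set ?_
    simp only [Expr.eval, Function.update_self]
    refine ⟨h8, ?_⟩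
    rwa [show s'.reg 8 - 1 = s'.reg 7 by omega]
  · simp only [Expr.cost]
    ring_nf
    omega

/-- Computes the coefficients of `g ρ - h σ`, then their value and `F`, which confine the number of
particles on `u_{n+1}` to an interval of length `x`, and searches in this interval. -/
def findProgram : Program :=
  .seq configCoeffProgram <|
  .seq pathValProgram <|
  .seq (.set 7 (.sub (.sub (.lit 0) (.div (.reg 8) (.reg 9))) (.lit 1))) <|
  .seq (.set 8 (.add (.reg 7) (.reg 2))) searchProgram

theorem findProgram_computes (hx : 0 < x) (hy : 0 < y) (hxy : Nat.Coprime x y)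
    (c : (pathGraph n x y).Config)
    (hm : rotorVal n x y c.1 - particleVal n x y c.2 + m * pathF n x y
      ∈ Set.range (rotorVal n x y)) :
    findProgram.Computes (inputConfig c 0) m
      ((Nat.log 2 x + 1) * (20 * n + 40) + 100 * n + 150) := by
  have hx' : (0 : ℤ) < x := by exact_mod_cast hx
  have hy' : (0 : ℤ) < y := by exact_mod_cast hy
  have hbd := neg_ediv_le_and_le hx hy hxy hm
  rw [rotorVal_mem_configCoeff_iff hx hy hxy] at hm
  have hmono := carry_strictMono hx'.le hy' (configCoeff c) n
  suffices h : findProgram.Runs (inputConfig c 0) (fun s' =>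
      0 ≤ carry x y (fun k => configCoeff c k + s'.reg 0) n ∧
        carry x y (fun k => configCoeff c k + (s'.reg 0 - 1)) n < 0)
      ((Nat.log 2 x + 1) * (20 * n + 40) + 100 * n + 150) by
    obtain ⟨s', t, h1, h2, h3⟩ := h
    exact ⟨s', t, h1, sign_change_unique hmono h2 hm, h3⟩
  refine .le (.seq (configCoeffProgram_runs c 0) (T' := 40 * n + 40 +
    ((Nat.log 2 x + 1) * (20 * n + 40) + 22)) fun s₁ h₁ => .seq (pathValProgram_runs h₁) ?_)
    (by omega)
  rintro s₂ ⟨h₂, h8, h9⟩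
  rw [pathVal_configCoeff] at h8
  rw [pathVal_one] at h9
  generalize rotorVal n x y c.1 - particleVal n x y c.2 = v at *
  set m₀ := -(v / pathF n x y) with hm₀
  refine .le (.set_seq (.set_seq (searchProgram_runs (L := Nat.log 2 x + 1)
    (m := 0) (c := configCoeff c) ⟨?_, ?_, ?_, ?_, ?_⟩ ?_ ?_ ?_ ?_))) ?_
  · simpa [Function.update_apply] using h₂.reg_one
  · simpa [Function.update_apply] using h₂.reg_two
  · simpa [Function.update_apply] using h₂.reg_three
  · simpa [Function.update_apply] using h₂.reg_four
  · exact h₂.arr_two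
  · simpa [Expr.eval, h₂.reg_two] using hx
  · have : x < 2 ^ (Nat.log 2 x + 1) := Nat.lt_pow_succ_log_self one_lt_two x
    simp [Expr.eval, h₂.reg_two]
    exact_mod_cast this.le
  -- The offset `m₀ - 1` lies below `m`, and `m₀ - 1 + x` does not.
  · have : carry x y (fun k => configCoeff c k + (m₀ - 1)) n
        ≤ carry x y (fun k => configCoeff c k + (m - 1)) n := hmono.monotone (by omega)
    simpa [Expr.eval, h8, h9] using this.trans_lt hm.2
  · have : carry x y (fun k => configCoeff c k + m) n
        ≤ carry x y (fun k => configCoeff c k + (m₀ - 1 + x)) n := hmono.monotone (by omega)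
    simpa [Expr.eval, h8, h9, h₂.reg_two] using hm.1.trans this
  · simp only [Expr.cost]
    omega

/-! ### Testing an arbitrary integer -/

/-- Coefficients of the integer `v`, if `A * x + B * y ^ n = 1`. -/
def bezoutCoeff (y v A B : ℤ) (n k : ℕ) : ℤ :=
  v * A ^ (n - k) * if k = 0 then 1 else B * y ^ (n - k)

theorem pathVal_bezoutCoeff {x y v A B : ℤ} {n : ℕ} (h : A * x + B * y ^ n = 1) :
    pathVal x y n (bezoutCoeff y v A B n) = v := by
  have key : ∀ k ∈ Finset.range n,
      bezoutCoeff y v A B n (k + 1) * (x ^ (n - (k + 1)) * y ^ (k + 1))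
        = v * (B * y ^ n) * (A * x) ^ (n - 1 - k) := by
    intro k hk
    have hk : k + 1 ≤ n := Finset.mem_range.1 hk
    have e : y ^ n = y ^ (n - (k + 1)) * y ^ (k + 1) := by rw [← pow_add, Nat.sub_add_cancel hk]
    rw [bezoutCoeff, if_neg k.succ_ne_zero, e, show n - 1 - k = n - (k + 1) by omega, mul_pow]
    ring
  rw [pathVal, Finset.sum_range_succ', Finset.sum_congr rfl key, ← Finset.mul_sum,
    Finset.sum_range_reflect (fun k => (A * x) ^ k) n, bezoutCoeff, if_pos rfl]
  have hg := geom_sum_mul (A * x) n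
  generalize ∑ k ∈ Finset.range n, (A * x) ^ k = S at *
  simp only [Nat.sub_zero, pow_zero, mul_one]
  linear_combination v * S * h - v * hg

/-- Puts `y ^ n` into register `6`, inverts it modulo `x` by the Euclidean algorithm, and writes
coefficients of the integer in register `4` into array `2`. -/
def intCoeffProgram : Program :=
  .seq (.set 6 (.lit 1)) <|
  .seq (.set 5 (.lit 1)) <|
  .seq (.whileLe (.reg 5) (.reg 1) <|
    .seq (.set 6 (.mul (.reg 6) (.reg 3))) <|
    .set 5 (.add (.reg 5) (.lit 1))) <|
  .seq (.set 7 (.reg 2)) <|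
  .seq (.set 8 (.mod (.reg 6) (.reg 2))) <|
  .seq (.set 9 (.lit 0)) <|
  .seq (.set 10 (.lit 1)) <|
  .seq (.whileLe (.lit 1) (.reg 8) <|
    .seq (.set 11 (.div (.reg 7) (.reg 8))) <|
    .seq (.set 12 (.sub (.reg 7) (.mul (.reg 11) (.reg 8)))) <|
    .seq (.set 7 (.reg 8)) <|
    .seq (.set 8 (.reg 12)) <|
    .seq (.set 12 (.sub (.reg 9) (.mul (.reg 11) (.reg 10)))) <|
    .seq (.set 9 (.reg 10)) <|
    .set 10 (.reg 12)) <|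
  .seq (.set 10 (.div (.sub (.lit 1) (.mul (.reg 9) (.reg 6))) (.reg 2))) <|
  .seq (.set 5 (.reg 1)) <|
  .seq (.whileLe (.lit 1) (.reg 5) <|
    .seq (.put 2 (.reg 5) (.mul (.reg 4) (.reg 9))) <|
    .seq (.set 4 (.mul (.reg 4) (.reg 10))) <|
    .seq (.set 9 (.mul (.reg 9) (.reg 3))) <|
    .set 5 (.sub (.reg 5) (.lit 1))) <|
  .seq (.put 2 (.lit 0) (.reg 4)) <|
  .set 4 (.lit 0)

theorem intCoeffProgram_runs (hx : 0 < x) (hxy : Nat.Coprime x y) (v : ℤ) :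
    intCoeffProgram.Runs (inputInt n x y v)
      (fun s' => ∃ c, HoldsCoeffs n x y 0 c s' ∧ pathVal x y n c = v)
      (40 * n + 80 * Nat.log 2 x + 200) := by
  have hx' : (0 : ℤ) < x := by exact_mod_cast hx
  have hcop : IsCoprime (x : ℤ) ((y : ℤ) ^ n) := (Nat.isCoprime_iff_coprime.2 hxy).pow_right
  -- The registers that no loop changes.
  let Fr : Memory → Prop := fun s => s.reg 1 = n ∧ s.reg 2 = x ∧ s.reg 3 = y
  have power : ∀ (T : ℕ) (q : Program) (P : Memory → Prop),
      (∀ s, Fr s → s.reg 4 = v → s.reg 6 = (y : ℤ) ^ n → q.Runs s P T) →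
      (Program.seq (.whileLe (.reg 5) (.reg 1)
        (.seq (.set 6 (.mul (.reg 6) (.reg 3))) (.set 5 (.add (.reg 5) (.lit 1))))) q).Runs
        ⟨Function.update (Function.update (inputInt n x y v).reg 6 1) 5 1,
          (inputInt n x y v).arr⟩ P (n * 11 + 3 + T) := by
    intro T q P hq
    let I : ℕ → Memory → Prop := fun j s => ∃ k : ℕ, k + j = n ∧ Fr s ∧ s.reg 4 = v ∧
      s.reg 5 = k + 1 ∧ s.reg 6 = (y : ℤ) ^ k
    refine .seq (.whileLe I 8 ?_ (k := n) ⟨0, by simp [Fr, inputInt, inputRegs]⟩) ?_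
    · rintro j s ⟨k, hk, ⟨h1, h2, h3⟩, h4, h5, h6⟩ hc
      simp only [Expr.eval, h5, h1] at hc
      obtain ⟨j, rfl⟩ := Nat.exists_eq_succ_of_ne_zero (show j ≠ 0 by omega)
      refine ⟨j, rfl, .le (.set_seq (.set ?_)) le_rfl⟩
      exact ⟨k + 1, by omega, by simp [Fr, h1, h2, h3],
        by simp [h4], by simp [Expr.eval, h5],
        by simp [Expr.eval, h6, h3, pow_succ]⟩
    · rintro s ⟨⟨j, k, hk, hF, h4, h5, h6⟩, hc⟩
      simp only [Expr.eval, h5, hF.1] at hc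
      obtain rfl : k = n := by omega
      exact hq s hF h4 h6
  have euclid : ∀ (T : ℕ) (q : Program) (P : Memory → Prop),
      (∀ s, Fr s → s.reg 4 = v → s.reg 6 = (y : ℤ) ^ n →
        (x : ℤ) ∣ 1 - s.reg 9 * (y : ℤ) ^ n → q.Runs s P T) →
      ∀ s, Fr s → s.reg 4 = v → s.reg 6 = (y : ℤ) ^ n → s.reg 7 = x →
        s.reg 8 = (y : ℤ) ^ n % x → s.reg 9 = 0 → s.reg 10 = 1 →
      (Program.seq (.whileLe (.lit 1) (.reg 8) <|
        .seq (.set 11 (.div (.reg 7) (.reg 8))) <|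
        .seq (.set 12 (.sub (.reg 7) (.mul (.reg 11) (.reg 8)))) <|
        .seq (.set 7 (.reg 8)) <|
        .seq (.set 8 (.reg 12)) <|
        .seq (.set 12 (.sub (.reg 9) (.mul (.reg 11) (.reg 10)))) <|
        .seq (.set 9 (.reg 10)) <|
        .set 10 (.reg 12)) q).Runs s P (2 * (Nat.log 2 x + 1) * 32 + 3 + T) := by
    intro T q P hq s hF h4 h6 h7 h8 h9 h10
    -- The product of consecutive remainders at least halves in each step.
    let I : ℕ → Memory → Prop := fun j s => Fr s ∧ s.reg 4 = v ∧ s.reg 6 = (y : ℤ) ^ n ∧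
      0 ≤ s.reg 8 ∧ s.reg 8 < s.reg 7 ∧ s.reg 7 * s.reg 8 < 2 ^ j ∧
      IsCoprime (s.reg 7) (s.reg 8) ∧ (x : ℤ) ∣ s.reg 7 - s.reg 9 * (y : ℤ) ^ n ∧
      (x : ℤ) ∣ s.reg 8 - s.reg 10 * (y : ℤ) ^ n
    refine .seq (.whileLe I 29 ?_ (k := 2 * (Nat.log 2 x + 1))
      ⟨hF, h4, h6, ?_, ?_, ?_, ?_, ?_, ?_⟩) ?_
    · clear hF h4 h6 h7 h8 h9 h10 s
      rintro j s ⟨⟨h1, h2, h3⟩, h4, h6, h8, h87, hj, hco, hd, hd'⟩ hc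
      simp only [Expr.eval] at hc
      obtain ⟨j, rfl⟩ : ∃ i, j = i + 1 := by
        refine Nat.exists_eq_succ_of_ne_zero ?_
        rintro rfl
        nlinarith
      refine ⟨j, rfl, .le (.set_seq (.set_seq (.set_seq (.set_seq (.set_seq (.set_seq
        (.set ?_))))))) (by decide)⟩
      have e1 := Int.emod_add_ediv_mul (s.reg 7) (s.reg 8)
      have e2 := Int.emod_nonneg (s.reg 7) (show s.reg 8 ≠ 0 by omega)
      have e3 := Int.emod_lt_of_pos (s.reg 7) (show 0 < s.reg 8 by omega)
      have e4 : 1 ≤ s.reg 7 / s.reg 8 := (Int.le_ediv_iff_mul_le (by omega)).2 (by omega)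
      simp only [I, Fr, Expr.eval, Function.update_apply, Nat.reduceEqDiff,
        OfNat.one_ne_ofNat, if_true, if_false, h1, h2, h3, h4, h6, true_and]
      generalize s.reg 7 / s.reg 8 = r at *
      have e5 : s.reg 7 - r * s.reg 8 = s.reg 7 % s.reg 8 := by linarith
      refine ⟨by linarith, by linarith, ?_, ?_, hd', ?_⟩
      · rw [pow_succ] at hj
        have e6 : 2 * (s.reg 7 - r * s.reg 8) ≤ s.reg 7 := by nlinarith
        nlinarith
      · have := hco.symm.add_mul_left_right (-r)
        rwa [show s.reg 7 - r * s.reg 8 = s.reg 7 + s.reg 8 * -r by ring]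
      · refine (dvd_sub hd (hd'.mul_left r)).trans (dvd_of_eq ?_)
        ring
    · rw [h8]; exact Int.emod_nonneg _ hx'.ne'
    · rw [h7, h8]; exact Int.emod_lt_of_pos _ hx'
    · rw [h7, h8]
      have h1 : x < 2 ^ (Nat.log 2 x + 1) := Nat.lt_pow_succ_log_self one_lt_two x
      have h2 : (x : ℤ) < 2 ^ (Nat.log 2 x + 1) := by exact_mod_cast h1
      have h3 := Int.emod_lt_of_pos ((y : ℤ) ^ n) hx'
      rw [two_mul, pow_add]
      nlinarith
    · rw [h7, h8, Int.emod_def, sub_eq_add_neg, ← mul_neg]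
      exact hcop.add_mul_left_right _
    · rw [h7, h9]; simp
    · rw [h8, h10, one_mul, Int.emod_def]
      exact ⟨-((y : ℤ) ^ n / x), by ring⟩
    · rintro s' ⟨⟨j, hF, h4, h6, h8, h87, -, hco, hd, -⟩, hc⟩
      simp only [Expr.eval] at hc
      have e8 : s'.reg 8 = 0 := by omega
      rw [e8, isCoprime_zero_right, Int.isUnit_iff] at hco
      have e7 : s'.reg 7 = 1 := by omega
      rw [e7] at hd
      exact hq s' hF h4 h6 hd
  have output : ∀ s, Fr s → s.reg 4 = v → s.reg 5 = n → s.reg 10 * x + s.reg 9 * (y : ℤ) ^ n = 1 →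
      (Program.seq (.whileLe (.lit 1) (.reg 5) <|
        .seq (.put 2 (.reg 5) (.mul (.reg 4) (.reg 9))) <|
        .seq (.set 4 (.mul (.reg 4) (.reg 10))) <|
        .seq (.set 9 (.mul (.reg 9) (.reg 3))) <|
        .set 5 (.sub (.reg 5) (.lit 1))) <|
      .seq (.put 2 (.lit 0) (.reg 4)) (.set 4 (.lit 0))).Runs s
        (fun s' => ∃ c, HoldsCoeffs n x y 0 c s' ∧ pathVal x y n c = v) (n * 20 + 8) := by
    intro s hF h4 h5 hAB
    obtain ⟨A, hA⟩ : ∃ A, s.reg 10 = A := ⟨_, rfl⟩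
    obtain ⟨B, hB⟩ : ∃ B, s.reg 9 = B := ⟨_, rfl⟩
    rw [hA, hB] at hAB
    let I : ℕ → Memory → Prop := fun k s => k ≤ n ∧ Fr s ∧ s.reg 4 = v * A ^ (n - k) ∧
      s.reg 5 = k ∧ s.reg 9 = B * (y : ℤ) ^ (n - k) ∧ s.reg 10 = A ∧
      ∀ i ≤ n, k < i → s.arr 2 i = bezoutCoeff y v A B n i
    refine .le (.seq (.whileLe I 17 ?_ (k := n) ⟨le_rfl, hF, by simpa using h4, h5,
      by simpa using hB, hA, fun i hi hi' => by omega⟩) (T' := 5) ?_) (by simp only [Expr.cost]; omega)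
    · rintro k s ⟨hk, ⟨h1, h2, h3⟩, h4, h5, h9, h10, harr⟩ hc
      simp only [Expr.eval, h5] at hc
      obtain ⟨k, rfl⟩ := Nat.exists_eq_succ_of_ne_zero (show k ≠ 0 by omega)
      have hsub : n - k = n - (k + 1) + 1 := by omega
      refine ⟨k, rfl, .le (.put_seq (.set_seq (.set_seq (.set ?_)))) (by decide)⟩
      refine ⟨by omega, by simp [Fr, h1, h2, h3], ?_, ?_, ?_, ?_,
        fun i hi hki => ?_⟩
      · simp [Expr.eval, h4, h10, hsub, pow_succ, mul_assoc]
      · simp [Expr.eval, h5]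
      · simp [Expr.eval, h9, h3, hsub, pow_succ, mul_assoc]
      · simpa [Function.update_apply] using h10
      · rcases (Nat.succ_le_of_lt hki).eq_or_lt with rfl | hki
        · simp [Expr.eval, h4, h5, h9, bezoutCoeff]
        · have : ¬ ((i : ℤ) = (k : ℤ) + 1) := by omega
          simpa [Expr.eval, h5, Function.update_apply, this] using harr i hi hki
    · rintro s' ⟨⟨k, hk, ⟨h1, h2, h3⟩, h4, h5, h9, h10, harr⟩, hc⟩
      simp only [Expr.eval, h5] at hc
      obtain rfl : k = 0 := by omega
      refine .le (.put_seq (.set ⟨_, ⟨?_, ?_, ?_, ?_, fun i hi => ?_⟩,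
        pathVal_bezoutCoeff hAB⟩)) (by decide)
      · simpa [Function.update_apply] using h1
      · simpa [Function.update_apply] using h2
      · simpa [Function.update_apply] using h3
      · simp [Expr.eval]
      · rcases i.eq_zero_or_pos with rfl | hi0
        · simp [Expr.eval, h4, bezoutCoeff]
        · simpa [Expr.eval, Function.update_apply, hi0.ne'] using harr i hi hi0
  refine .le (.set_seq (.set_seq (power (64 * Nat.log 2 x + 20 * n + 120) _ _
    fun s hF h4 h6 => .le (.set_seq (.set_seq (.set_seq (.set_seq (euclid (n * 20 + 30) _ _ ?_ _
      ?_ ?_ ?_ ?_ ?_ ?_ ?_))))) ?_))) ?_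
  · rintro s ⟨h1, h2, h3⟩ h4 h6 hd
    refine .le (.set_seq (.set_seq (output _ ?_ ?_ ?_ ?_))) (by simp only [Expr.cost]; omega)
    · simp [Fr, h1, h2, h3]
    · simpa [Function.update_apply] using h4
    · simp [Expr.eval, h1]
    · simp [Expr.eval, h6, h2, Int.ediv_mul_cancel hd]
  · simpa [Fr, Function.update_apply] using hF
  · simpa [Function.update_apply] using h4
  · simpa [Function.update_apply] using h6
  · simp [Expr.eval, hF.2.1]
  · simp [Expr.eval, hF.2.1, h6]
  · simp [Expr.eval]
  · simp [Expr.eval]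
  · simp only [Expr.cost]
    omega
  · simp only [Expr.cost]
    omega

theorem testIntProgram_decides (hx : 0 < x) (hy : 0 < y) (hxy : Nat.Coprime x y) (v : ℤ) :
    (Program.seq intCoeffProgram signTestProgram).Decides (inputInt n x y v)
      (v ∈ Set.range (rotorVal n x y)) (80 * n + 80 * Nat.log 2 x + 260) := by
  classical
  refine Program.Runs.decides <| .le (.seq (intCoeffProgram_runs hx hxy v)
    (T' := 40 * n + 60) ?_) (by omega)
  rintro s ⟨c, hs, rfl⟩
  simp only [rotorVal_mem_iff hx hy hxy]
  simpa using signTestProgram_runs hs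

end RotorRouting

open RotorRouting in
theorem mainTheorem1 :
    ∃ (h : ∀ n _x _y : ℕ, ParticleConfig (Fin (n + 2)) →ₗ[ℤ] ℤ)
      (g : ∀ n x y : ℕ, (pathGraph n x y).RotorConfig → ℤ)
      (testInt testConfig find : Program) (C : ℕ),
      ∀ n x y : ℕ, 1 ≤ n → 0 < x → x < y → Nat.Coprime x y →
        -- (i)
        (∀ (ρ : (pathGraph n x y).RotorConfig) (σ : ParticleConfig (Fin (n + 2))),
          ((pathGraph n x y).routingInf (ρ, σ)).Nonempty ∧
          ∀ c ∈ (pathGraph n x y).routingInf (ρ, σ), ∀ m : ℤ,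
            c.2 (Fin.last (n + 1)) = m ↔
              g n x y ρ - h n x y σ + m * (pathF n x y : ℤ) ∈ Set.range (g n x y)) ∧
        -- (ii)
        ((Set.range (g n x y)).Finite ∧ (∀ v ∈ Set.range (g n x y), 0 ≤ v) ∧
          (∀ v : ℤ, testInt.Decides (inputInt n x y v) (v ∈ Set.range (g n x y))
            (C * (n + Nat.log 2 x))) ∧
          (∀ (ρ : (pathGraph n x y).RotorConfig) (σ : ParticleConfig (Fin (n + 2))) (m : ℤ),
            testConfig.Decides (inputConfig (ρ, σ) m)
              (g n x y ρ - h n x y σ + m * (pathF n x y : ℤ) ∈ Set.range (g n x y)) (C * n)) ∧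
          (∀ (ρ : (pathGraph n x y).RotorConfig) (σ : ParticleConfig (Fin (n + 2))),
            ∃! m : ℤ, g n x y ρ - h n x y σ + m * (pathF n x y : ℤ) ∈ Set.range (g n x y)) ∧
          (∀ (ρ : (pathGraph n x y).RotorConfig) (σ : ParticleConfig (Fin (n + 2))) (m : ℤ),
            g n x y ρ - h n x y σ + m * (pathF n x y : ℤ) ∈ Set.range (g n x y) →
              find.Computes (inputConfig (ρ, σ) 0) m (C * (n * (Nat.log 2 x + 1))) ∧
              m - ⌈((h n x y σ - g n x y ρ : ℤ) : ℚ) / (pathF n x y : ℚ)⌉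
                ∈ Set.Icc (0 : ℤ) ((x : ℤ) - 1))) ∧
        -- (iii)
        (∀ (ρ ρ' : (pathGraph n x y).RotorConfig) (σ σ' : ParticleConfig (Fin (n + 2))),
          (pathGraph n x y).Equivalent (ρ, σ) (ρ', σ') ↔
            g n x y ρ - h n x y σ = g n x y ρ' - h n x y σ' ∧ deg σ = deg σ') := by
  refine ⟨particleVal, rotorVal, .seq intCoeffProgram signTestProgram,
    .seq configCoeffProgram signTestProgram, findProgram, 400, fun n x y hn hx hxy hco => ?_⟩
  have hy : 0 < y := hx.trans hxy
  have hF : (0 : ℤ) < pathF n x y := by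
    rw [← pathVal_one]; exact pathVal_one_pos (by exact_mod_cast hx) (by exact_mod_cast hy)
  refine ⟨fun ρ σ => routingInf_spec hx hy hco (ρ, σ), ⟨?_, fun v hv =>
    (rotorVal_nonneg_lt hx hy hco hv).1, fun v => ?_, fun ρ σ m => ?_,
    fun ρ σ => existsUnique_rotorVal_mem hx hy hco (ρ, σ), fun ρ σ m hm => ⟨?_, ?_⟩⟩,
    fun ρ ρ' σ σ' => ?_⟩
  · exact (Set.finite_Ico (0 : ℤ) (x * pathF n x y)).subset fun v hv =>
      rotorVal_nonneg_lt hx hy hco hv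
  · exact (testIntProgram_decides hx hy hco v).le (by omega)
  · have h := testConfigProgram_decides (ρ, σ) m
    rw [← rotorVal_mem_configCoeff_iff hx hy hco] at h
    exact h.le (by omega)
  · obtain ⟨s', t, h1, h2, h3⟩ := findProgram_computes hx hy hco (ρ, σ) hm
    refine ⟨s', t, h1, h2, h3.trans ?_⟩
    nlinarith [Nat.zero_le (Nat.log 2 x)]
  · have h := neg_ediv_le_and_le hx hy hco hm
    rw [← neg_sub (rotorVal n x y ρ), show (pathF n x y : ℚ) = ((pathF n x y : ℤ) : ℚ) by simp,
      ceil_eq_neg_ediv hF, Set.mem_Icc]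
    omega
  · rw [← pathVal_configCoeff (ρ, σ), ← pathVal_configCoeff (ρ', σ')]
    exact ⟨invariants_eq_of_equivalent (by omega) hy,
      fun h => equivalent_of_invariants_eq hx hy hco h.1 h.2⟩
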